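/- Let $K$ be a field of characteristic $0$ and let $p\ge 1$ be an integer. Let $K\langle X\rangle$ be the free unital associative algebra on $X=\{x_1,x_2,\dots\}$, and put $[u,v]=uv-vu$, $[u_1,\dots,u_{k+1}]=[[u_1,\dots,u_k],u_{k+1}]$. Let $I_{p+1}$ be the two-sided ideal of $K\langle X\rangle$ generated by all commutators $[u_1,\dots,u_{p+1}]$ with $u_i\in K\langle X\rangle$. For $n\ge 0$ let $X_n=\{x_1,\dots,x_n\}$ and let $F_n(\mathfrak N_p)=K\langle X_n\rangle/(K\langle X_n\rangle\cap I_{p+1})$ be the relatively free algebra of rank $n$ in the variety $\mathfrak N_p$ of Lie nilpotent associative algebras of index at most $p$; the symmetric group $S_n$ acts on it by permuting the variables. Let $\Gamma_n(\mathfrak N_p)\subseteq F_n(\mathfrak N_p)$ be the image of the space $\Gamma_n$ of proper multilinear polynomials of degree $n$, i.e. of those linear combinations of the monomials $x_{\sigma(1)}\cdots x_{\sigma(n)}$ $(\sigma\in S_n)$ that are also linear combinations of (possibly empty) products of commutators $[x_{i_1},\dots,x_{i_r}]$, $r\ge 2$, in the variables. Let $f_p\in K\langle X_{2p-2}\rangle$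 be the complete multilinearization of $[x_1,x_2]^{p-1}$, i.e. the multilinear component of $$[\,x_1+\dots+x_{p-1},\;x_p+\dots+x_{2p-2}\,]^{p-1}.$$ **Proposition 3.3.** The image of $f_p$ in $F_{2p-2}(\mathfrak N_p)$ generates an irreducible $S_{2p-2}$-submodule of $\Gamma_{2p-2}(\mathfrak N_p)$, and this submodule is isomorphic to the irreducible $S_{2p-2}$-module (Specht module) $M(p-1,p-1)$ over $K$ corresponding to the partition $(p-1,p-1)$ of $2p-2$. Moreover, neither $[x_1,x_2]^{p-1}$ nor $f_p$ is a polynomial identity of the algebra $E_2^{\otimes(p-1)}=E_2\otimes\cdots\otimes E_2$ ($p-1$ factors, tensor product of algebras over $K$), where $E_2$ is the Grassmann algebra of a $2$-dimensional $K$-vector space. -/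

import Mathlib

noncomputable section

namespace LieNilpotent

/-! ### Commutators, the ideals `I_q`, and polynomial identities -/

/-- The left-normed commutator `[u, v₁, …, vₖ] = [⋯[[u, v₁], v₂], …, vₖ]`, with `[a, b] = ab - ba`;
its length is `k + 1`. -/
def leftNormed {A : Type*} [Ring A] (u : A) (v : List A) : A :=
  v.foldl (fun a b => ⁅a, b⁆) u

/-- The two-sided ideal `I_q` of `K⟨X⟩`, `X = {x₀, x₁, …}`, generated by all commutators
`[u₁, …, u_q]` of length `q` with `u₁, …, u_q ∈ K⟨X⟩`. -/
def commutatorIdeal (K : Type*) [Field K] (q : ℕ) : TwoSidedIdeal (FreeAlgebra K ℕ) :=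
  TwoSidedIdeal.span
    {w | ∃ (u : FreeAlgebra K ℕ) (v : List (FreeAlgebra K ℕ)),
      v.length + 1 = q ∧ w = leftNormed u v}

/-- `f` is a polynomial identity of the algebra `A`. -/
def IsIdentity {K X : Type*} [Field K] (f : FreeAlgebra K X) (A : Type*) [Ring A] [Algebra K A] :
    Prop :=
  ∀ a : X → A, FreeAlgebra.lift K a f = 0

/-- The Grassmann algebra `E_r` of an `r`-dimensional vector space. -/
abbrev Grassmann (K : Type*) [Field K] (r : ℕ) : Type _ := ExteriorAlgebra K (Fin r → K)

/-- The tensor power `E_r ⊗ ⋯ ⊗ E_r` with `l` factors (ordinary, ungraded, tensor product of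
algebras). -/
abbrev GrassmannPower (K : Type*) [Field K] (r l : ℕ) : Type _ :=
  PiTensorProduct K (fun _ : Fin l => Grassmann K r)

/-! ### The free algebra of rank `n` and the relatively free algebra `F_n(𝔑_p)` -/

/-- The embedding `K⟨X_n⟩ → K⟨X⟩`. -/
def incl (K : Type*) [Field K] (n : ℕ) : FreeAlgebra K (Fin n) →ₐ[K] FreeAlgebra K ℕ :=
  FreeAlgebra.lift K fun i => FreeAlgebra.ι K (i : ℕ)

/-- The ideal `I_{p+1} ∩ K⟨X_n⟩` of `K⟨X_n⟩`. -/
def relIdeal (K : Type*) [Field K] (p n : ℕ) : TwoSidedIdeal (FreeAlgebra K (Fin n)) :=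
  (commutatorIdeal K (p + 1)).comap (incl K n)

/-- `F_n(𝔑_p) = K⟨X_n⟩ / (I_{p+1} ∩ K⟨X_n⟩)`, the relatively free algebra of rank `n` in the
variety of Lie nilpotent associative algebras of index at most `p`. -/
abbrev RelFree (K : Type*) [Field K] (p n : ℕ) : Type _ := (relIdeal K p n).ringCon.Quotient

/-- The quotient map `K⟨X_n⟩ → F_n(𝔑_p)`. -/
def toRelFree (K : Type*) [Field K] (p n : ℕ) : FreeAlgebra K (Fin n) →ₐ[K] RelFree K p n :=
  (relIdeal K p n).ringCon.mkₐ K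

/-! ### The action of the symmetric group by permutation of the variables -/

/-- The automorphism `x_i ↦ x_{σ(i)}` of `K⟨X_n⟩`. -/
def permHom (K : Type*) [Field K] {n : ℕ} (σ : Equiv.Perm (Fin n)) :
    FreeAlgebra K (Fin n) →ₐ[K] FreeAlgebra K (Fin n) :=
  FreeAlgebra.lift K fun i => FreeAlgebra.ι K (σ i)

theorem permHom_one (K : Type*) [Field K] (n : ℕ) :
    permHom K (1 : Equiv.Perm (Fin n)) = AlgHom.id K _ := by
  ext i
  simp [permHom]

theorem permHom_mul (K : Type*) [Field K] {n : ℕ} (σ τ : Equiv.Perm (Fin n)) :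
    permHom K (σ * τ) = (permHom K σ).comp (permHom K τ) := by
  ext i
  simp [permHom]

theorem map_leftNormed {K A B : Type*} [Field K] [Ring A] [Ring B] [Algebra K A] [Algebra K B]
    (φ : A →ₐ[K] B) (u : A) (v : List A) :
    φ (leftNormed u v) = leftNormed (φ u) (v.map φ) := by
  induction v generalizing u with
  | nil => rfl
  | cons a v ih =>
    have h := ih ⁅u, a⁆
    simp only [leftNormed, List.foldl_cons, List.map_cons] at h ⊢
    rw [h]
    simp [Ring.lie_def]

theorem map_mem_commutatorIdeal {K : Type*} [Field K] {q : ℕ}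
    (φ : FreeAlgebra K ℕ →ₐ[K] FreeAlgebra K ℕ) {f : FreeAlgebra K ℕ}
    (hf : f ∈ commutatorIdeal K q) : φ f ∈ commutatorIdeal K q := by
  have h : commutatorIdeal K q ≤ (commutatorIdeal K q).comap (φ : FreeAlgebra K ℕ →+* _) := by
    refine TwoSidedIdeal.span_le.mpr ?_
    rintro w ⟨u, v, hv, rfl⟩
    refine (TwoSidedIdeal.mem_comap _).mpr (TwoSidedIdeal.subset_span ?_)
    exact ⟨φ u, v.map φ, by simpa using hv, map_leftNormed φ u v⟩
  exact (TwoSidedIdeal.mem_comap _).mp (h hf)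

theorem permHom_mem_relIdeal {K : Type*} [Field K] {p n : ℕ} (σ : Equiv.Perm (Fin n))
    {f : FreeAlgebra K (Fin n)} (hf : f ∈ relIdeal K p n) : permHom K σ f ∈ relIdeal K p n := by
  let φ : FreeAlgebra K ℕ →ₐ[K] FreeAlgebra K ℕ :=
    FreeAlgebra.lift K fun i => if h : i < n then FreeAlgebra.ι K ((σ ⟨i, h⟩ : Fin n) : ℕ) else 0
  have h : (incl K n).comp (permHom K σ) = φ.comp (incl K n) := by
    ext i
    simp [incl, permHom, φ]
  have h' : incl K n (permHom K σ f) = φ (incl K n f) := DFunLike.congr_fun h f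
  refine (TwoSidedIdeal.mem_comap _).mpr ?_
  rw [h']
  exact map_mem_commutatorIdeal φ ((TwoSidedIdeal.mem_comap _).mp hf)

/-- The automorphism of `F_n(𝔑_p)` induced by `x_i ↦ x_{σ(i)}`. -/
def relPermHom (K : Type*) [Field K] (p : ℕ) {n : ℕ} (σ : Equiv.Perm (Fin n)) :
    RelFree K p n →ₐ[K] RelFree K p n :=
  (relIdeal K p n).ringCon.liftₐ ((toRelFree K p n).comp (permHom K σ)) (by
    intro x y hxy
    refine (RingCon.eq _).mpr ?_
    have h := permHom_mem_relIdeal σ (((relIdeal K p n).rel_iff x y).mp hxy)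
    rw [map_sub] at h
    exact ((relIdeal K p n).rel_iff _ _).mpr h)

theorem relPermHom_toRelFree (K : Type*) [Field K] (p : ℕ) {n : ℕ} (σ : Equiv.Perm (Fin n))
    (f : FreeAlgebra K (Fin n)) :
    relPermHom K p σ (toRelFree K p n f) = toRelFree K p n (permHom K σ f) := rfl

theorem toRelFree_surjective (K : Type*) [Field K] (p n : ℕ) :
    Function.Surjective (toRelFree K p n) :=
  (relIdeal K p n).ringCon.mkₐ_surjective

/-- The `S_n`-module structure of `F_n(𝔑_p)`: `σ` acts by `x_i ↦ x_{σ(i)}`. -/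
def relFreeRep (K : Type*) [Field K] (p n : ℕ) :
    Representation K (Equiv.Perm (Fin n)) (RelFree K p n) where
  toFun σ := (relPermHom K p σ).toLinearMap
  map_one' := by
    ext x
    obtain ⟨f, rfl⟩ := toRelFree_surjective K p n x
    simp [relPermHom_toRelFree, permHom_one]
  map_mul' σ τ := by
    ext x
    obtain ⟨f, rfl⟩ := toRelFree_surjective K p n x
    simp [relPermHom_toRelFree, permHom_mul]

/-! ### Multilinear and proper polynomials -/

/-- `P_n ⊆ K⟨X_n⟩`, spanned by the monomials `x_{σ(1)} ⋯ x_{σ(n)}`. -/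
def multilinear (K : Type*) [Field K] (n : ℕ) : Submodule K (FreeAlgebra K (Fin n)) :=
  Submodule.span K (Set.range fun σ : Equiv.Perm (Fin n) =>
    (List.ofFn fun i => FreeAlgebra.ι K (σ i)).prod)

/-- Proper polynomials: linear combinations of (possibly empty) products of pure commutators
`[x_{i₁}, …, x_{i_r}]`, `r ≥ 2`. -/
def proper (K : Type*) [Field K] (n : ℕ) : Subalgebra K (FreeAlgebra K (Fin n)) :=
  Algebra.adjoin K
    {w | ∃ (i : Fin n) (l : List (Fin n)),
      l ≠ [] ∧ w = leftNormed (FreeAlgebra.ι K i) (l.map (FreeAlgebra.ι K))}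

/-- `Γ_n`, the space of proper multilinear polynomials of degree `n`. -/
def properMultilinear (K : Type*) [Field K] (n : ℕ) : Submodule K (FreeAlgebra K (Fin n)) :=
  multilinear K n ⊓ Subalgebra.toSubmodule (proper K n)

/-- `Γ_n(𝔑_p)`, the image of `Γ_n` in `F_n(𝔑_p)`. -/
def properMultilinearRel (K : Type*) [Field K] (p n : ℕ) : Submodule K (RelFree K p n) :=
  (properMultilinear K n).map (toRelFree K p n).toLinearMap

theorem permHom_mem_multilinear {K : Type*} [Field K] {n : ℕ} (σ : Equiv.Perm (Fin n))
    {f : FreeAlgebra K (Fin n)} (hf : f ∈ multilinear K n) : permHom K σ f ∈ multilinear K n := by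
  have h : multilinear K n ≤ (multilinear K n).comap (permHom K σ).toLinearMap := by
    refine Submodule.span_le.mpr ?_
    rintro _ ⟨τ, rfl⟩
    refine Submodule.subset_span ⟨σ * τ, ?_⟩
    simp [map_list_prod, List.map_ofFn, permHom, Function.comp_def]
  exact h hf

theorem permHom_mem_proper {K : Type*} [Field K] {n : ℕ} (σ : Equiv.Perm (Fin n))
    {f : FreeAlgebra K (Fin n)} (hf : f ∈ proper K n) : permHom K σ f ∈ proper K n := by
  have h : proper K n ≤ (proper K n).comap (permHom K σ) := by
    refine Algebra.adjoin_le ?_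
    rintro _ ⟨i, l, hl, rfl⟩
    refine Algebra.subset_adjoin ⟨σ i, l.map σ, by simpa using hl, ?_⟩
    have := map_leftNormed (permHom K σ) (FreeAlgebra.ι K i)
      (l.map (FreeAlgebra.ι K))
    simpa [permHom, Function.comp_def] using this
  exact h hf

/-- `Γ_n(𝔑_p)` as an `S_n`-submodule of `F_n(𝔑_p)`. -/
def properMultilinearSubrep (K : Type*) [Field K] (p n : ℕ) :
    Subrepresentation (relFreeRep K p n) where
  toSubmodule := properMultilinearRel K p n
  apply_mem_toSubmodule := by
    rintro σ _ ⟨f, ⟨hf₁, hf₂⟩, rfl⟩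
    exact ⟨permHom K σ f, ⟨permHom_mem_multilinear σ hf₁, permHom_mem_proper σ hf₂⟩, rfl⟩

/-! ### Complete multilinearization -/

open scoped Classical in
/-- The multilinear component of a polynomial in `K⟨X_n⟩`: all monomials in which each of
the `n` variables occurs exactly once are kept, all others are dropped. -/
def multilinearPart (K : Type*) [Field K] (n : ℕ) :
    FreeAlgebra K (Fin n) →ₗ[K] FreeAlgebra K (Fin n) :=
  (FreeAlgebra.basisFreeMonoid K (Fin n)).constr K fun w =>
    if ∀ i : Fin n, w.toList.count i = 1 then FreeAlgebra.basisFreeMonoid K (Fin n) w else 0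

/-- The complete multilinearization of a polynomial `f` in the variables `x_i`, `i ∈ ι`.
The fibre `b⁻¹(i)` is the set of new variables that replace `x_i` (for `f` homogeneous in each `x_i`,
there have to be `deg_{x_i} f` of them): it is the multilinear component of the polynomial obtained
by substituting for each `x_i` the sum of these new variables. -/
def linearization {K ι : Type*} [Field K] [DecidableEq ι] {n : ℕ} (b : Fin n → ι)
    (f : FreeAlgebra K ι) : FreeAlgebra K (Fin n) :=
  multilinearPart K n
    (FreeAlgebra.lift K (fun i : ι => ∑ j : Fin n with b j = i, FreeAlgebra.ι K j) f)

/-! ### Submodules generated by one element -/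

/-- The `G`-submodule generated by `v`. -/
def generatedBy {K G V : Type*} [Field K] [Group G] [AddCommGroup V] [Module K V]
    (ρ : Representation K G V) (v : V) : Subrepresentation ρ where
  toSubmodule := Submodule.span K (Set.range fun g : G => ρ g v)
  apply_mem_toSubmodule := by
    intro g w hw
    have h : Submodule.span K (Set.range fun g : G => ρ g v) ≤
        (Submodule.span K (Set.range fun g : G => ρ g v)).comap (ρ g) := by
      refine Submodule.span_le.mpr ?_
      rintro _ ⟨g', rfl⟩
      exact Submodule.subset_span ⟨g * g', by simp⟩
    exact h hw

/-! ### The `S_n`-module `M(μ)` of a partition `μ` of `n` (Specht module) -/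

/-- The permutation module on the row assignments `r : {1, …, n} → ℕ`. A tabloid is recorded by the
function that sends each entry to the index of its row; `σ` sends `r` to `r ∘ σ⁻¹`. -/
def tabloidRep (K : Type*) [Field K] (n : ℕ) :
    Representation K (Equiv.Perm (Fin n)) ((Fin n → ℕ) →₀ K) where
  toFun σ := Finsupp.lmapDomain K K fun r => r ∘ σ.symm
  map_one' := by
    exact Finsupp.lmapDomain_id K K
  map_mul' σ τ := by
    ext r : 2
    simp [Finsupp.lmapDomain_apply, Finsupp.mapDomain_single]
    rfl

/-- The polytabloid `∑_c sgn(c) c{T}` of a tableau `T` of shape `μ`, given as the function sending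
each entry `1, …, n` to its cell; the sum is over the column group of `T`. -/
def polytabloid (K : Type*) [Field K] {n : ℕ} {μ : YoungDiagram} (T : Fin n ≃ μ.cells) :
    (Fin n → ℕ) →₀ K :=
  ∑ c : Equiv.Perm (Fin n) with ∀ i, (T (c i)).1.2 = (T i).1.2,
    ((Equiv.Perm.sign c : ℤ) : K) • tabloidRep K n c (Finsupp.single (fun i => (T i).1.1) 1)

theorem tabloidRep_polytabloid (K : Type*) [Field K] {n : ℕ} {μ : YoungDiagram}
    (T : Fin n ≃ μ.cells) (σ : Equiv.Perm (Fin n)) :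
    tabloidRep K n σ (polytabloid K T) = polytabloid K (σ.symm.trans T) := by
  unfold polytabloid
  rw [map_sum]
  refine Finset.sum_bij' (fun c _ => σ * c * σ⁻¹) (fun c _ => σ⁻¹ * c * σ) ?_ ?_ ?_ ?_ ?_
  · intro c hc
    simp only [Finset.mem_filter, Finset.mem_univ, true_and] at hc ⊢
    intro i
    simpa using hc (σ.symm i)
  · intro c hc
    simp only [Finset.mem_filter, Finset.mem_univ, true_and] at hc ⊢
    intro i
    simpa using hc (σ i)
  · intro c _
    group
  · intro c _
    group
  · intro c _
    have hs : Equiv.Perm.sign (σ * c * σ⁻¹) = Equiv.Perm.sign c := by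
      rw [map_mul, map_mul, mul_right_comm, ← map_mul, mul_inv_cancel, map_one, one_mul]
    have ht : tabloidRep K n σ (Finsupp.single (fun i => ((T i).1.1 : ℕ)) 1) =
        Finsupp.single (fun i => ((σ.symm.trans T) i).1.1) 1 := by
      exact Finsupp.mapDomain_single
    rw [hs, map_smul, ← ht]
    congr 1
    simp only [← Module.End.mul_apply, ← map_mul]
    congr 2
    group

/-- `M(μ)`: the Specht module, spanned by the polytabloids of all tableaux of shape `μ`. Over a
field of characteristic zero these are, for `μ ⊢ n`, the irreducible `S_n`-modules. -/
def spechtModule (K : Type*) [Field K] (n : ℕ) (μ : YoungDiagram) :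
    Subrepresentation (tabloidRep K n) where
  toSubmodule := Submodule.span K (Set.range fun T : Fin n ≃ μ.cells => polytabloid K T)
  apply_mem_toSubmodule := by
    intro σ w hw
    have h : Submodule.span K (Set.range fun T : Fin n ≃ μ.cells => polytabloid K T) ≤
        (Submodule.span K (Set.range fun T : Fin n ≃ μ.cells => polytabloid K T)).comap
          (tabloidRep K n σ) := by
      refine Submodule.span_le.mpr ?_
      rintro _ ⟨T, rfl⟩
      exact Submodule.subset_span ⟨σ.symm.trans T, (tabloidRep_polytabloid K T σ).symm⟩
    exact h hw

/-- The Young diagram of the partition `(m, m)`. -/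
def twoRows (m : ℕ) : YoungDiagram :=
  YoungDiagram.ofRowLens [m, m] (by simp [List.sortedGE_iff_pairwise])

/-! ### The polynomial `[x₁, x₂]^{p-1}` -/

/-- The polynomial `[x₁, x₂]^m` in `K⟨x₁, x₂⟩`. -/
def commPow (K : Type*) [Field K] (m : ℕ) : FreeAlgebra K (Fin 2) :=
  ⁅FreeAlgebra.ι K (0 : Fin 2), FreeAlgebra.ι K (1 : Fin 2)⁆ ^ m

/-- The complete multilinearization of `[x₁, x₂]^{p-1}`, a polynomial of degree `2p - 2`: the variable
`x₁` is replaced by the first `p - 1` variables, and `x₂` by the last `p - 1`. -/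
def commPowLin (K : Type*) [Field K] (p : ℕ) : FreeAlgebra K (Fin (2 * p - 2)) :=
  linearization (fun j => if (j : ℕ) < p - 1 then (0 : Fin 2) else 1) (commPow K (p - 1))

end LieNilpotent

end

/-! Put `m = p - 1`. For an assignment `r` of the variables to two rows, with row sums x and y, let
L(r) be the multilinear part of [x, y]^m. Permuting variables permutes the L(r) in the same way as
the tabloids `r`, so r ↦ L(r) extends to an equivariant map Φ (`tabloidMap`) from the tabloid module
to the relatively free algebra. The polynomial f_p is L(r₀) for the standard rows r₀. The claim is
that Φ maps the Specht module S of shape (m, m) isomorphically onto the submodule W generated by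
f_p. Three facts give this.

S is irreducible (`isIrreducible_spechtModule_twoRows`). The column antisymmetrizer of a tableau
sends S into the line of its polytabloid and multiplies that polytabloid by 2^m. Maschke's theorem
then excludes proper summands.

The image of f_p lies in Φ(S) (`sum_flipSum_linearization`). From [x + y, tx + y] = (1 - t)[x, y],
comparing powers of t shows that the sum of L(r) over all `r` moving exactly j first-row entries to
the second row is (-1)^j C(m, j) L(r₀). Summing the polytabloids over all rearrangements of the
second row gives each such tabloid with rows of size m the coefficient (-1)^j j! (m - j)!;
assignments with other row sizes have L(r) = 0. Hence the sum maps to (m + 1) · m! · L(r₀).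

The image of f_p is nonzero (`toRelFree_linearization_ne_zero`). In the tensor power of E_2, let z_j
be the product of the two generators of factor j. The z_j are central with square zero, and each
bracket contributes one more factor z_j, so commutators of length m + 2 = p + 1 vanish. Substituting
the 2m generators for the variables sends f_p to 2^m m! z_1 ⋯ z_m ≠ 0. This evaluation and a similar
one for [x_1, x_2]^m also refute the two identities.

Since S is irreducible and some element of S maps to f_p ≠ 0, the kernel of Φ on S is zero and the
preimage of W in S is all of S. As Φ(S) contains the generator of W, the restriction is a bijection
S → W (`exists_bijective_intertwiningMap`). -/

noncomputable section

namespace LieNilpotent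

open Finset

/-! ### Multilinear parts, multidegrees and proper polynomials -/

section MultilinearPart

variable {K : Type*} [Field K] {n : ℕ}

theorem basisFreeMonoid_apply {X : Type*} (w : FreeMonoid X) :
    FreeAlgebra.basisFreeMonoid K X w = (w.toList.map (FreeAlgebra.ι K)).prod := by
  have h : FreeAlgebra.basisFreeMonoid K X w =
      FreeAlgebra.equivMonoidAlgebraFreeMonoid.symm (MonoidAlgebra.single w 1) := rfl
  rw [h]
  change MonoidAlgebra.lift K (FreeAlgebra K X) (FreeMonoid X)
    (FreeMonoid.lift (FreeAlgebra.ι K)) _ = _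
  rw [MonoidAlgebra.lift_single, one_smul, FreeMonoid.lift_apply]

theorem freeAlgebra_linearMap_ext {X V : Type*} [AddCommGroup V] [Module K V]
    {f g : FreeAlgebra K X →ₗ[K] V}
    (h : ∀ w : List X, f (w.map (FreeAlgebra.ι K)).prod = g (w.map (FreeAlgebra.ι K)).prod) :
    f = g := by
  refine (FreeAlgebra.basisFreeMonoid K X).ext fun w => ?_
  rw [basisFreeMonoid_apply]
  exact h w.toList

theorem multilinearPart_word (w : List (Fin n)) :
    multilinearPart K n (w.map (FreeAlgebra.ι K)).prod =
      if ∀ i : Fin n, w.count i = 1 then (w.map (FreeAlgebra.ι K)).prod else 0 := by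
  have h := basisFreeMonoid_apply (K := K) (FreeMonoid.ofList w)
  rw [FreeMonoid.toList_ofList] at h
  rw [← h, multilinearPart, Module.Basis.constr_basis, FreeMonoid.toList_ofList]

theorem bijective_of_count_ofFn {d : ℕ} {φ : Fin d → Fin n}
    (h : ∀ i, (List.ofFn φ).count i = 1) : Function.Bijective φ := by
  constructor
  · rw [← List.nodup_ofFn, List.nodup_iff_count_le_one]
    exact fun i => (h i).le
  · intro i
    have : i ∈ List.ofFn φ := List.count_pos_iff.mp (by rw [h i]; exact one_pos)
    simpa [List.mem_ofFn] using this

theorem prod_ofFn_sum_smul {A : Type*} [Ring A] [Algebra K A] {d : ℕ} (c : Fin d → Fin n → K)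
    (x : Fin n → A) :
    (List.ofFn fun k => ∑ i, c k i • x i).prod =
      ∑ φ : Fin d → Fin n, (∏ k, c k (φ k)) • ((List.ofFn φ).map x).prod := by
  have h := (MultilinearMap.mkPiAlgebraFin K d A).map_sum
    (fun (k : Fin d) (i : Fin n) => c k i • x i)
  simp only [MultilinearMap.map_smul_univ, MultilinearMap.mkPiAlgebraFin_apply] at h
  rw [h]
  simp [List.map_ofFn, Function.comp_def]

/-- The multilinear part of `f(∑ᵢ uᵢ₀ xᵢ, ∑ᵢ uᵢ₁ xᵢ)`. -/
theorem multilinearPart_lift (u : Fin n → Fin 2 → K) (f : FreeAlgebra K (Fin 2)) :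
    multilinearPart K n
        (FreeAlgebra.lift K (fun s => ∑ i, u i s • FreeAlgebra.ι K i) f) =
      ∑ r : Fin n → Fin 2, (∏ i, u i (r i)) • linearization r f := by
  suffices h : multilinearPart K n ∘ₗ
      (FreeAlgebra.lift K (fun s => ∑ i, u i s • FreeAlgebra.ι K i)).toLinearMap =
      ∑ r : Fin n → Fin 2, (∏ i, u i (r i)) • (multilinearPart K n ∘ₗ
        (FreeAlgebra.lift K
          (fun s => ∑ i, (if r i = s then (1 : K) else 0) • FreeAlgebra.ι K i)).toLinearMap) by
    have := LinearMap.congr_fun h f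
    simpa [linearization, Finset.sum_filter, LinearMap.sum_apply] using this
  refine freeAlgebra_linearMap_ext fun w => ?_
  obtain ⟨d, z, rfl⟩ : ∃ (d : ℕ) (z : Fin d → Fin 2), w = List.ofFn z :=
    ⟨w.length, w.get, (List.ofFn_get w).symm⟩
  simp only [LinearMap.comp_apply, LinearMap.sum_apply, LinearMap.smul_apply,
    AlgHom.toLinearMap_apply, map_list_prod, List.map_ofFn, Function.comp_def,
    FreeAlgebra.lift_ι_apply, prod_ofFn_sum_smul, map_sum, map_smul, Finset.smul_sum]
  rw [Finset.sum_comm]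
  refine Finset.sum_congr rfl fun φ _ => ?_
  simp only [← List.map_ofFn, ← Function.comp_def]
  rw [multilinearPart_word]
  split_ifs with h
  · have hφ := bijective_of_count_ofFn h
    let e := Equiv.ofBijective φ hφ
    simp only [smul_smul]
    rw [← Finset.sum_smul]
    congr 1
    -- Position `k` of the word carries the letter `z k` and receives the variable `φ k`. When `φ`
    -- is a bijection, exactly one row assignment is compatible with both.
    rw [Finset.sum_eq_single (z ∘ e.symm)]
    · have h1 : ∀ k, (z ∘ e.symm) (φ k) = z k := fun k => by
        change z (e.symm (e k)) = _
        simp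
      simp only [h1, if_true, Finset.prod_const_one, mul_one]
      refine Fintype.prod_equiv e _ _ fun k => ?_
      change _ = u (φ k) ((z ∘ e.symm) (φ k))
      rw [h1]
    · intro r _ hr
      have : ∃ k, r (φ k) ≠ z k := by
        by_contra! hc
        refine hr (funext fun i => ?_)
        have := hc (e.symm i)
        rw [Function.comp_apply, ← this]
        exact congrArg r (e.apply_symm_apply i).symm
      obtain ⟨k, hk⟩ := this
      rw [Finset.prod_eq_zero (Finset.mem_univ k) (by simp [hk]), mul_zero]
    · simp
  · simp

theorem multilinearPart_permHom (σ : Equiv.Perm (Fin n)) (f : FreeAlgebra K (Fin n)) :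
    multilinearPart K n (permHom K σ f) = permHom K σ (multilinearPart K n f) := by
  suffices h : multilinearPart K n ∘ₗ (permHom K σ).toLinearMap =
      (permHom K σ).toLinearMap ∘ₗ multilinearPart K n from LinearMap.congr_fun h f
  refine freeAlgebra_linearMap_ext fun w => ?_
  have hw : permHom K σ (w.map (FreeAlgebra.ι K)).prod =
      ((w.map σ).map (FreeAlgebra.ι K)).prod := by
    simp [permHom, map_list_prod, Function.comp_def]
  have hc : (∀ i, (w.map σ).count i = 1) ↔ ∀ i, w.count i = 1 := by
    rw [← σ.forall_congr_right]
    simp [List.count_map_of_injective _ _ σ.injective]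
  simp only [LinearMap.comp_apply, AlgHom.toLinearMap_apply]
  rw [hw, multilinearPart_word, multilinearPart_word]
  simp only [hc]
  split_ifs
  · exact hw.symm
  · simp

theorem multilinearPart_mem_multilinear (f : FreeAlgebra K (Fin n)) :
    multilinearPart K n f ∈ multilinear K n := by
  suffices h : (⊤ : Submodule K (FreeAlgebra K (Fin n))) ≤
      (multilinear K n).comap (multilinearPart K n) from h trivial
  rw [← (FreeAlgebra.basisFreeMonoid K (Fin n)).span_eq, Submodule.span_le]
  rintro _ ⟨w, rfl⟩
  rw [SetLike.mem_coe, Submodule.mem_comap, basisFreeMonoid_apply, multilinearPart_word]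
  split_ifs with h
  · obtain ⟨d, z, hz⟩ : ∃ (d : ℕ) (z : Fin d → Fin n), w.toList = List.ofFn z :=
      ⟨w.toList.length, w.toList.get, (List.ofFn_get _).symm⟩
    rw [hz] at h ⊢
    have hφ := bijective_of_count_ofFn h
    obtain rfl : d = n := by simpa using Fintype.card_of_bijective hφ
    refine Submodule.subset_span ⟨Equiv.ofBijective z hφ, ?_⟩
    simp [List.map_ofFn, Function.comp_def]
  · exact zero_mem _

/-- The polynomials of multidegree `d`. -/
def multihomogeneous (K : Type*) [Field K] {X : Type*} (d : Multiset X) :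
    Submodule K (FreeAlgebra K X) :=
  Submodule.span K {f | ∃ w : List X, (w : Multiset X) = d ∧ f = (w.map (FreeAlgebra.ι K)).prod}

theorem ι_mem_multihomogeneous {X : Type*} (i : X) :
    FreeAlgebra.ι K i ∈ multihomogeneous K {i} :=
  Submodule.subset_span ⟨[i], by simp, by simp⟩

theorem mul_mem_multihomogeneous {X : Type*} {d e : Multiset X} {f g : FreeAlgebra K X}
    (hf : f ∈ multihomogeneous K d) (hg : g ∈ multihomogeneous K e) :
    f * g ∈ multihomogeneous K (d + e) := by
  have h := Submodule.mul_mem_mul hf hg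
  rw [multihomogeneous, multihomogeneous, Submodule.span_mul_span] at h
  refine Submodule.span_mono ?_ h
  rintro _ ⟨_, ⟨v, rfl, rfl⟩, _, ⟨w, rfl, rfl⟩, rfl⟩
  exact ⟨v ++ w, by simp, by simp⟩

theorem lie_mem_multihomogeneous {X : Type*} {d e : Multiset X} {f g : FreeAlgebra K X}
    (hf : f ∈ multihomogeneous K d) (hg : g ∈ multihomogeneous K e) :
    ⁅f, g⁆ ∈ multihomogeneous K (d + e) := by
  rw [Ring.lie_def]
  exact sub_mem (mul_mem_multihomogeneous hf hg)
    (add_comm d e ▸ mul_mem_multihomogeneous hg hf)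

theorem leftNormed_mem_multihomogeneous {X : Type*} (l : List X) {d : Multiset X}
    {f : FreeAlgebra K X} (hf : f ∈ multihomogeneous K d) :
    leftNormed f (l.map (FreeAlgebra.ι K)) ∈ multihomogeneous K (d + (l : Multiset X)) := by
  induction l generalizing d f with
  | nil => simpa [leftNormed] using hf
  | cons a l ih =>
    have := ih (lie_mem_multihomogeneous hf (ι_mem_multihomogeneous (K := K) a))
    rw [add_assoc] at this
    simpa [leftNormed] using this

theorem multilinearPart_of_mem_multihomogeneous {d : Multiset (Fin n)}
    {f : FreeAlgebra K (Fin n)} (hf : f ∈ multihomogeneous K d) :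
    multilinearPart K n f = if ∀ i, d.count i = 1 then f else 0 := by
  induction hf using Submodule.span_induction with
  | mem f h =>
    obtain ⟨w, rfl, rfl⟩ := h
    simpa using multilinearPart_word w
  | zero => simp
  | add f g _ _ hf hg => rw [map_add, hf, hg]; split_ifs <;> simp
  | smul a f _ hf => rw [map_smul, hf]; split_ifs <;> simp

/-- Products of commutators of variables span the proper polynomials and are multihomogeneous, so
the projection either fixes or kills each of them. -/
theorem multilinearPart_mem_proper {f : FreeAlgebra K (Fin n)} (hf : f ∈ proper K n) :
    multilinearPart K n f ∈ proper K n := by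
  have hf' : f ∈ Subalgebra.toSubmodule (proper K n) := hf
  rw [proper, Algebra.adjoin_eq_span] at hf'
  induction hf' using Submodule.span_induction with
  | mem f h =>
    have h1 : f ∈ proper K n ∧ ∃ d, f ∈ multihomogeneous K d := by
      clear hf
      induction h using Submonoid.closure_induction with
      | mem f h =>
        refine ⟨Algebra.subset_adjoin h, ?_⟩
        obtain ⟨i, l, -, rfl⟩ := h
        exact ⟨_, leftNormed_mem_multihomogeneous l (ι_mem_multihomogeneous i)⟩
      | one => exact ⟨one_mem _, 0, Submodule.subset_span ⟨[], by simp, by simp⟩⟩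
      | mul f g _ _ hf hg =>
        obtain ⟨hf, d, hd⟩ := hf
        obtain ⟨hg, e, he⟩ := hg
        exact ⟨mul_mem hf hg, _, mul_mem_multihomogeneous hd he⟩
    obtain ⟨-, d, hd⟩ := h1
    rw [multilinearPart_of_mem_multihomogeneous hd]
    split_ifs
    · exact hf
    · exact zero_mem _
  | zero => simp
  | add f g hf' hg' ihf ihg =>
    rw [← Algebra.adjoin_eq_span] at hf' hg'
    rw [map_add]
    exact add_mem (ihf hf') (ihg hg')
  | smul a f hf' ihf =>
    rw [← Algebra.adjoin_eq_span] at hf'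
    rw [map_smul]
    exact Subalgebra.smul_mem _ (ihf hf') a

end MultilinearPart

/-! ### Linear relations between the linearizations of [x, y]^m -/

section Relations

variable {K : Type*} [Field K] {n : ℕ}

theorem lift_commPow {A : Type*} [Ring A] [Algebra K A] (m : ℕ) (a : Fin 2 → A) :
    FreeAlgebra.lift K a (commPow K m) = ⁅a 0, a 1⁆ ^ m := by
  simp [commPow, Ring.lie_def]

/-- Doubling every variable of row 0 multiplies the multilinear part by 2 to the size of that row,
but multiplies [x, y]^m by 2^m. In characteristic zero these factors agree only if the row has size
`m`. -/
theorem linearization_commPow_of_card_ne [CharZero K] {m : ℕ} {r : Fin n → Fin 2}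
    (h : #{i | r i = 0} ≠ m) : linearization r (commPow K m) = 0 := by
  let c : Fin 2 → K := fun s => if s = 0 then 2 else 1
  have h1 := multilinearPart_lift (fun i s => if r i = s then c s else 0) (commPow K m)
  rw [Finset.sum_eq_single r] at h1
  · have h2 : ∏ i, c (r i) = 2 ^ #{i | r i = 0} := by
      simp [c, Finset.prod_ite]
    have h3 : ∀ s, ∑ i, (if r i = s then c s else 0) • FreeAlgebra.ι K i =
        c s • ∑ i with r i = s, FreeAlgebra.ι K i := by
      intro s
      simp [Finset.sum_filter, Finset.smul_sum]
    have h4 : ⁅c 0 • ∑ i with r i = 0, FreeAlgebra.ι K i,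
        c 1 • ∑ i with r i = 1, FreeAlgebra.ι K i⁆ ^ m = (2 : K) ^ m •
          ⁅∑ i with r i = 0, FreeAlgebra.ι K i, ∑ i with r i = 1, FreeAlgebra.ι K i⁆ ^ m := by
      rw [← smul_pow]
      simp [c, Ring.lie_def, smul_sub]
    simp only [if_true, h2, h3, lift_commPow, h4, map_smul] at h1
    rw [linearization, lift_commPow, ← sub_eq_zero, ← sub_smul] at h1
    rw [linearization, lift_commPow]
    refine (smul_eq_zero.mp h1).resolve_left (sub_ne_zero.mpr fun h5 => h ?_)
    have h6 : (2 : ℕ) ^ m = 2 ^ #{i | r i = 0} := by exact_mod_cast h5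
    exact (Nat.pow_right_injective le_rfl h6).symm
  · intro r' _ hr
    obtain ⟨i, hi⟩ := Function.ne_iff.mp hr
    rw [Finset.prod_eq_zero (Finset.mem_univ i) (by simp [hi.symm]), zero_smul]
  · simp

/-- With x and y the row sums of `r₀`, this is the multilinear part of [x + y, tx + y]^m = (1 - t)^m
[x, y]^m. On the left each variable chooses a slot, and a factor t records a row-0 variable that
chooses the second slot. -/
theorem sum_pow_smul_linearization_commPow (m : ℕ) (r₀ : Fin n → Fin 2) (t : K) :
    ∑ r : Fin n → Fin 2, t ^ #{i | r₀ i = 0 ∧ r i = 1} • linearization r (commPow K m) =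
      (1 - t) ^ m • linearization r₀ (commPow K m) := by
  have h1 := multilinearPart_lift
    (fun i s => if r₀ i = 0 ∧ s = 1 then t else 1) (commPow K m)
  have h2 : ∀ r : Fin n → Fin 2, ∏ i, (if r₀ i = 0 ∧ r i = 1 then t else 1) =
      t ^ #{i | r₀ i = 0 ∧ r i = 1} := by
    intro r
    simp [Finset.prod_ite]
  simp only [h2] at h1
  rw [← h1, lift_commPow, linearization, lift_commPow, ← map_smul, ← smul_pow]
  set x := ∑ i with r₀ i = 0, FreeAlgebra.ι K i with hx
  set y := ∑ i with r₀ i = 1, FreeAlgebra.ι K i with hy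
  have h3 : ∀ i, r₀ i = 1 ↔ ¬ r₀ i = 0 := by
    intro i
    generalize r₀ i = s
    revert s
    decide
  have h4 : ∑ i, (if r₀ i = 0 ∧ (0 : Fin 2) = 1 then t else 1) • FreeAlgebra.ι K i = x + y := by
    simp only [hx, hy, h3, Finset.sum_filter_add_sum_filter_not]
    simp
  have h5 : ∑ i, (if r₀ i = 0 ∧ (1 : Fin 2) = 1 then t else 1) • FreeAlgebra.ι K i =
      t • x + y := by
    simp only [hx, hy, h3, Finset.smul_sum, Finset.sum_filter, ← Finset.sum_add_distrib]
    refine Finset.sum_congr rfl fun i _ => ?_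
    by_cases h : r₀ i = 0 <;> simp [h]
  rw [h4, h5]
  congr 2
  simp only [Ring.lie_def, add_mul, mul_add, smul_mul_assoc, mul_smul_comm, sub_smul, smul_sub,
    smul_add, one_smul]
  abel

theorem coeff_one_sub_X_pow (m j : ℕ) :
    ((1 - Polynomial.X : Polynomial K) ^ m).coeff j = (-1) ^ j * (m.choose j : K) := by
  have h : (1 - Polynomial.X : Polynomial K) ^ m =
      ((1 + Polynomial.X) ^ m).comp (Polynomial.C (-1) * Polynomial.X) := by
    simp [sub_eq_add_neg]
  rw [h, Polynomial.comp_C_mul_X_coeff, Polynomial.coeff_one_add_X_pow, mul_comm]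

/-- Linear functionals reduce the vector-valued identity to scalar polynomials in t, which over an
infinite field may be compared coefficientwise. -/
theorem sum_eq_choose_smul_of_forall [Infinite K] {V ι : Type*} [AddCommGroup V] [Module K V]
    [Fintype ι] (F : ι → V) (k : ι → ℕ) (v : V) (m : ℕ)
    (h : ∀ t : K, ∑ r, t ^ k r • F r = (1 - t) ^ m • v) (j : ℕ) :
    ∑ r with k r = j, F r = ((-1) ^ j * (m.choose j : K)) • v := by
  rw [← sub_eq_zero, ← Module.forall_dual_apply_eq_zero_iff K]
  intro φ
  have h1 : ∑ r, Polynomial.C (φ (F r)) * Polynomial.X ^ k r =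
      Polynomial.C (φ v) * (1 - Polynomial.X) ^ m := by
    refine Polynomial.funext fun t => ?_
    have := congrArg φ (h t)
    simp only [map_sum, map_smul, smul_eq_mul] at this
    simp only [Polynomial.eval_finsetSum, Polynomial.eval_mul, Polynomial.eval_C,
      Polynomial.eval_pow, Polynomial.eval_X, Polynomial.eval_sub, Polynomial.eval_one]
    rw [mul_comm (φ v), ← this]
    exact Finset.sum_congr rfl fun r _ => mul_comm _ _
  have h2 := congrArg (fun P => Polynomial.coeff P j) h1
  simp only [Polynomial.finsetSum_coeff, Polynomial.coeff_C_mul, Polynomial.coeff_X_pow,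
    coeff_one_sub_X_pow, mul_ite, mul_one, mul_zero] at h2
  rw [map_sub, map_sum, map_smul, smul_eq_mul, Finset.sum_filter, sub_eq_zero, mul_comm, ← h2]
  simp only [eq_comm]

end Relations

/-! ### An irreducibility criterion -/

/-- A representation generated by `e` is irreducible if some operator that preserves all
subrepresentations maps everything into the line of `e`, and `e` to a nonzero multiple of itself. -/
theorem isIrreducible_of_rank_one {K G V : Type*} [Field K] [CharZero K] [Group G] [Finite G]
    [AddCommGroup V] [Module K V] (ρ : Representation K G V) (e : V) (he : e ≠ 0)
    (hgen : ∀ U : Subrepresentation ρ, e ∈ U.toSubmodule → U = ⊤) (κ : Module.End K V)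
    (hκU : ∀ (U : Subrepresentation ρ) (x : V), x ∈ U.toSubmodule → κ x ∈ U.toSubmodule)
    (hκe : ∀ x, ∃ a : K, κ x = a • e) (d : K) (hd : d ≠ 0) (hκ : κ e = d • e) :
    ρ.IsIrreducible := by
  have hU : ∀ (U : Subrepresentation ρ) (x) (_ : x ∈ U.toSubmodule), κ x ≠ 0 → U = ⊤ := by
    intro U x hx hne
    obtain ⟨a, ha⟩ := hκe x
    have ha0 : a ≠ 0 := by
      rintro rfl
      exact hne (by rw [ha, zero_smul])
    have h2 := hκU U x hx
    rw [ha] at h2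
    exact hgen U ((Submodule.smul_mem_iff _ ha0).mp h2)
  have : Nontrivial (Subrepresentation ρ) := by
    refine ⟨⊥, ⊤, fun h => he ?_⟩
    have : e ∈ (⊥ : Subrepresentation ρ).toSubmodule := by
      rw [h]
      exact Submodule.mem_top
    exact (Submodule.mem_bot K).mp this
  refine ⟨fun U => ?_⟩
  -- Maschke's theorem supplies a complement. Splitting `e` along the decomposition, `κ` cannot kill
  -- both components because `κ e ≠ 0`, and the summand with a surviving component contains `e`.
  have : NeZero (Nat.card G : K) := ⟨Nat.cast_ne_zero.mpr Nat.card_pos.ne'⟩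
  obtain ⟨U', hU'⟩ := exists_isCompl U
  have htop : e ∈ (U ⊔ U').toSubmodule := by
    rw [hU'.sup_eq_top]
    exact Submodule.mem_top
  rw [Subrepresentation.toSubmodule_sup] at htop
  obtain ⟨x, hx, y, hy, hxy⟩ := Submodule.mem_sup.mp htop
  have hsum : κ x + κ y ≠ 0 := by
    rw [← map_add, hxy, hκ]
    exact smul_ne_zero hd he
  by_cases h : κ x = 0
  · left
    have h2 := hU U' y hy (by simpa [h] using hsum)
    simpa [h2] using hU'.inf_eq_bot
  · exact Or.inr (hU U x hx h)

/-! ### Irreducibility of the Specht module of shape (m, m) -/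

section TwoRowSpecht

variable {K : Type*} [Field K] {m n : ℕ}

/-- The cells of the diagram `(m, m)`, as pairs (column, row). -/
def twoRowsCells (m : ℕ) : Fin m × Fin 2 ≃ (twoRows m).cells where
  toFun x := ⟨(x.2, x.1), by
    rw [YoungDiagram.mem_cells, twoRows, YoungDiagram.mem_ofRowLens]
    obtain ⟨j, s⟩ := x
    fin_cases s <;> simp⟩
  invFun c := (⟨c.1.2, by
      obtain ⟨⟨i, j⟩, h⟩ := c
      rw [YoungDiagram.mem_cells, twoRows, YoungDiagram.mem_ofRowLens] at h
      obtain ⟨h1, h2⟩ := h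
      simp only [List.length_cons, List.length_nil] at h1
      interval_cases i <;> simpa using h2⟩, ⟨c.1.1, by
      obtain ⟨⟨i, j⟩, h⟩ := c
      rw [YoungDiagram.mem_cells, twoRows, YoungDiagram.mem_ofRowLens] at h
      simpa using h.1⟩)
  left_inv x := rfl
  right_inv c := rfl

/-- The sign of the element of the column group that flips the columns `j` with `p j = 1`. -/
def flipSign (K : Type*) [Field K] (p : Fin m → Fin 2) : K := ∏ j, (-1) ^ (p j : ℕ)

/-- The tabloid obtained from the tableau `T` by flipping the columns `j` with `p j = 1`. -/
def flipRow (T : Fin n ≃ Fin m × Fin 2) (p : Fin m → Fin 2) (i : Fin n) : Fin 2 :=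
  p (T i).1 + (T i).2

/-- The element of the column group of `T` that flips the columns `j` with `p j = 1`. -/
def flipPerm (T : Fin n ≃ Fin m × Fin 2) (p : Fin m → Fin 2) : Equiv.Perm (Fin n) :=
  T.trans ((Equiv.prodCongrRight fun j => Equiv.addLeft (p j)).trans T.symm)

theorem flipPerm_apply (T : Fin n ≃ Fin m × Fin 2) (p : Fin m → Fin 2) (i : Fin n) :
    T (flipPerm T p i) = ((T i).1, p (T i).1 + (T i).2) := by
  simp [flipPerm, Equiv.prodCongrRight]

theorem fin_two_add_add_self (a b : Fin 2) : a + (a + b) = b := by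
  revert a b; decide

theorem flipPerm_symm (T : Fin n ≃ Fin m × Fin 2) (p : Fin m → Fin 2) :
    (flipPerm T p).symm = flipPerm T p := by
  ext i : 1
  rw [Equiv.symm_apply_eq]
  apply T.injective
  simp [flipPerm_apply, fin_two_add_add_self]

theorem sign_flipPerm (T : Fin n ≃ Fin m × Fin 2) (p : Fin m → Fin 2) :
    ((Equiv.Perm.sign (flipPerm T p) : ℤ) : K) = flipSign K p := by
  have h : Equiv.Perm.sign (flipPerm T p) =
      Equiv.Perm.sign (Equiv.prodCongrRight fun j => Equiv.addLeft (p j)) :=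
    Equiv.Perm.sign_symm_trans_trans (Equiv.prodCongrRight fun j => Equiv.addLeft (p j)) T.symm
  have h2 : ∀ s : Fin 2, Equiv.Perm.sign (Equiv.addLeft s) = (-1) ^ (s : ℕ) := by decide
  rw [h, Equiv.Perm.sign_prodCongrRight, flipSign]
  simp [h2]

/-- The polytabloid of a tableau of shape `(m, m)`. -/
def flipSum (K : Type*) [Field K] (T : Fin n ≃ Fin m × Fin 2) : (Fin n → ℕ) →₀ K :=
  ∑ p : Fin m → Fin 2, flipSign K p • Finsupp.single (fun i => (flipRow T p i : ℕ)) 1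

theorem tabloidRep_single (σ : Equiv.Perm (Fin n)) (r : Fin n → ℕ) :
    tabloidRep K n σ (Finsupp.single r 1) = Finsupp.single (r ∘ σ.symm) 1 :=
  Finsupp.mapDomain_single

/-- The columns have two cells each, so the column group is (ℤ/2)^m and its elements are the column
flips. -/
theorem polytabloid_trans_twoRowsCells (T : Fin n ≃ Fin m × Fin 2) :
    polytabloid K (T.trans (twoRowsCells m)) = flipSum K T := by
  unfold polytabloid flipSum
  symm
  refine Finset.sum_bij (fun p _ => flipPerm T p) ?_ ?_ ?_ ?_
  · intro p _
    rw [Finset.mem_filter]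
    exact ⟨Finset.mem_univ _, fun i => congrArg (fun x => (x.1 : ℕ)) (flipPerm_apply T p i)⟩
  · intro p _ q _ h
    funext j
    have := congrArg (fun σ => T (σ (T.symm (j, 0)))) h
    simpa [flipPerm_apply] using this
  · intro c hc
    simp only [Finset.mem_filter, Finset.mem_univ, true_and] at hc
    have hc' : ∀ i, (T (c i)).1 = (T i).1 := fun i => Fin.ext (hc i)
    -- Whether column `j` is flipped is read off from its top entry; injectivity of `c` forces the
    -- bottom entry into the opposite row.
    refine ⟨fun j => (T (c (T.symm (j, 0)))).2, Finset.mem_univ _, ?_⟩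
    ext i : 1
    apply T.injective
    rw [flipPerm_apply]
    refine Prod.ext (hc' i).symm ?_
    have h2 : ∀ s : Fin 2, s = 0 ∨ s = 1 := by decide
    obtain ⟨⟨j, s⟩, rfl⟩ := T.symm.surjective i
    rcases h2 s with rfl | rfl
    · simp
    · have hne : (T (c (T.symm (j, 1)))).2 ≠ (T (c (T.symm (j, 0)))).2 := by
        intro h
        have h3 : T (c (T.symm (j, 1))) = T (c (T.symm (j, 0))) :=
          Prod.ext (by rw [hc', hc']; simp) h
        simp at h3
      simp only [Equiv.apply_symm_apply]
      generalize (T (c (T.symm (j, 1)))).2 = a at hne ⊢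
      generalize (T (c (T.symm (j, 0)))).2 = b at hne ⊢
      revert a b
      decide
  · intro p _
    rw [sign_flipPerm, tabloidRep_single, flipPerm_symm]
    congr 3
    funext i
    simp [twoRowsCells, flipPerm_apply, flipRow]

theorem spechtModule_twoRows :
    (spechtModule K n (twoRows m)).toSubmodule =
      Submodule.span K (Set.range fun T : Fin n ≃ Fin m × Fin 2 => flipSum K T) := by
  have h : (Set.range fun T : Fin n ≃ (twoRows m).cells => polytabloid K T) =
      Set.range fun T : Fin n ≃ Fin m × Fin 2 => flipSum K T := by
    ext v
    constructor
    · rintro ⟨T, rfl⟩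
      refine ⟨T.trans (twoRowsCells m).symm, ?_⟩
      simp only [← polytabloid_trans_twoRowsCells]
      congr 1
    · rintro ⟨T, rfl⟩
      exact ⟨T.trans (twoRowsCells m), polytabloid_trans_twoRowsCells T⟩
  rw [← h]
  rfl

theorem flipSum_mem_spechtModule (T : Fin n ≃ Fin m × Fin 2) :
    flipSum K T ∈ (spechtModule K n (twoRows m)).toSubmodule := by
  rw [spechtModule_twoRows]
  exact Submodule.subset_span ⟨T, rfl⟩

theorem tabloidRep_flipSum (T : Fin n ≃ Fin m × Fin 2) (σ : Equiv.Perm (Fin n)) :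
    tabloidRep K n σ (flipSum K T) = flipSum K (σ.symm.trans T) := by
  rw [← polytabloid_trans_twoRowsCells, tabloidRep_polytabloid, ← polytabloid_trans_twoRowsCells]
  rfl

/-- The column antisymmetrizer of a tableau of shape `(m, m)`. -/
def flipAntisymmetrizer (K : Type*) [Field K] (T : Fin n ≃ Fin m × Fin 2) :
    Module.End K ((Fin n → ℕ) →₀ K) :=
  ∑ p : Fin m → Fin 2, flipSign K p • tabloidRep K n (flipPerm T p)

theorem flipSign_add (p q : Fin m → Fin 2) :
    flipSign K (p + q) = flipSign K p * flipSign K q := by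
  have h : ∀ a b : Fin 2, (-1 : K) ^ ((a + b : Fin 2) : ℕ) = (-1) ^ (a : ℕ) * (-1) ^ (b : ℕ) := by
    intro a b
    fin_cases a <;> fin_cases b <;> simp
  simp [flipSign, h, Finset.prod_mul_distrib]

theorem flipSign_mul_self (p : Fin m → Fin 2) : flipSign K p * flipSign K p = 1 := by
  simp [flipSign, ← Finset.prod_mul_distrib, ← mul_pow]

theorem flipAntisymmetrizer_single (T : Fin n ≃ Fin m × Fin 2) (r : Fin n → ℕ) :
    flipAntisymmetrizer K T (Finsupp.single r 1) =
      ∑ p : Fin m → Fin 2, flipSign K p • Finsupp.single (r ∘ flipPerm T p) 1 := by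
  simp [flipAntisymmetrizer, LinearMap.sum_apply, tabloidRep_single, flipPerm_symm]

theorem flipAntisymmetrizer_flipRow (T : Fin n ≃ Fin m × Fin 2) (q : Fin m → Fin 2) :
    flipAntisymmetrizer K T (Finsupp.single (fun i => (flipRow T q i : ℕ)) 1) =
      flipSign K q • flipSum K T := by
  rw [flipAntisymmetrizer_single, flipSum, Finset.smul_sum]
  refine Fintype.sum_equiv (Equiv.addLeft q) _ _ fun p => ?_
  rw [smul_smul, Equiv.coe_addLeft, flipSign_add, ← mul_assoc, flipSign_mul_self, one_mul]
  congr 2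
  funext i
  simp [flipRow, flipPerm_apply, add_assoc]

/-- Flipping column `j` in addition reverses the sign and leaves the tabloid unchanged, so the terms
cancel in pairs. -/
theorem flipAntisymmetrizer_of_eq (T : Fin n ≃ Fin m × Fin 2) (r : Fin n → ℕ) (j : Fin m)
    (h : r (T.symm (j, 0)) = r (T.symm (j, 1))) :
    flipAntisymmetrizer K T (Finsupp.single r 1) = 0 := by
  rw [flipAntisymmetrizer_single]
  have hs : flipSign K (Pi.single j 1 : Fin m → Fin 2) = -1 := by
    rw [flipSign, Finset.prod_eq_single j]
    · simp
    · intro k _ hk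
      simp [hk]
    · simp
  refine Finset.sum_involution (fun p _ => Pi.single j 1 + p) ?_ ?_ ?_ ?_
  · intro p _
    have h2 : r ∘ flipPerm T (Pi.single j 1 + p) = r ∘ flipPerm T p := by
      funext i
      obtain ⟨⟨k, s⟩, rfl⟩ := T.symm.surjective i
      have h3 : ∀ q, flipPerm T q (T.symm (k, s)) = T.symm (k, q k + s) := by
        intro q
        apply T.injective
        simp [flipPerm_apply]
      simp only [Function.comp_apply, h3, Pi.add_apply]
      by_cases hk : k = j
      · subst hk
        have h4 : ∀ a : Fin 2, r (T.symm (k, a)) = r (T.symm (k, 0)) := by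
          intro a
          fin_cases a
          · rfl
          · exact h.symm
        rw [h4, h4 (p k + s)]
      · simp [hk]
    rw [flipSign_add, hs, h2]
    simp
  · intro p _ _
    simp
  · simp
  · intro p _
    funext k
    exact fin_two_add_add_self _ _

/-- Either some column of `T` has both entries in the same row of `r`, and the terms cancel, or `r`
separates every column and is thus a column flip of `T`. -/
theorem flipAntisymmetrizer_mem_span (T : Fin n ≃ Fin m × Fin 2) (r : Fin n → Fin 2) :
    flipAntisymmetrizer K T (Finsupp.single (fun i => (r i : ℕ)) 1) ∈
      Submodule.span K {flipSum K T} := by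
  by_cases h : ∃ j, r (T.symm (j, 0)) = r (T.symm (j, 1))
  · obtain ⟨j, hj⟩ := h
    rw [flipAntisymmetrizer_of_eq T _ j (by rw [hj])]
    exact zero_mem _
  · push Not at h
    have h2 : r = flipRow T fun j => r (T.symm (j, 0)) := by
      funext i
      obtain ⟨⟨j, s⟩, rfl⟩ := T.symm.surjective i
      have := h j
      simp only [flipRow, Equiv.apply_symm_apply]
      have h3 : ∀ s : Fin 2, s = 0 ∨ s = 1 := by decide
      rcases h3 s with rfl | rfl
      · simp
      · generalize r (T.symm (j, 0)) = a at *
        generalize r (T.symm (j, 1)) = b at *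
        revert a b
        decide
    rw [h2, flipAntisymmetrizer_flipRow]
    exact Submodule.smul_mem _ _ (Submodule.mem_span_singleton_self _)

theorem flipAntisymmetrizer_flipSum (T : Fin n ≃ Fin m × Fin 2) :
    flipAntisymmetrizer K T (flipSum K T) = (2 : K) ^ m • flipSum K T := by
  conv_lhs => rw [flipSum]
  simp only [map_sum, map_smul, flipAntisymmetrizer_flipRow, smul_smul, flipSign_mul_self]
  simp [← Nat.cast_smul_eq_nsmul K]

theorem flipAntisymmetrizer_mem_span_of_mem (T : Fin n ≃ Fin m × Fin 2)
    {v : (Fin n → ℕ) →₀ K} (hv : v ∈ (spechtModule K n (twoRows m)).toSubmodule) :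
    flipAntisymmetrizer K T v ∈ Submodule.span K {flipSum K T} := by
  suffices h : (spechtModule K n (twoRows m)).toSubmodule ≤
      (Submodule.span K {flipSum K T}).comap (flipAntisymmetrizer K T) from h hv
  rw [spechtModule_twoRows, Submodule.span_le]
  rintro _ ⟨T', rfl⟩
  refine sum_mem fun p _ => Submodule.smul_mem _ _ ?_
  exact flipAntisymmetrizer_mem_span T (flipRow T' p)

theorem flipSum_ne_zero (T : Fin n ≃ Fin m × Fin 2) : flipSum K T ≠ 0 := by
  intro h
  have h2 := DFunLike.congr_fun h (fun i => (flipRow T 0 i : ℕ))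
  rw [flipSum, Finsupp.finsetSum_apply, Finset.sum_eq_single 0] at h2
  · simp [flipSign] at h2
  · intro p _ hp
    rw [Finsupp.smul_apply, Finsupp.single_eq_of_ne, smul_zero]
    intro h3
    refine hp (funext fun j => ?_)
    have := congrFun h3 (T.symm (j, 0))
    simp only [flipRow, Equiv.apply_symm_apply, Fin.val_inj] at this
    simpa using this.symm
  · simp

/-- A subrepresentation of the Specht module that contains a polytabloid is everything. -/
theorem subrepresentation_eq_top_of_flipSum_mem (T : Fin n ≃ Fin m × Fin 2)
    (U : Subrepresentation (spechtModule K n (twoRows m)).toRepresentation)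
    (h : (⟨flipSum K T, flipSum_mem_spechtModule T⟩ :
      (spechtModule K n (twoRows m)).toSubmodule) ∈ U.toSubmodule) : U = ⊤ := by
  refine top_le_iff.mp fun x _ => ?_
  obtain ⟨x, hx⟩ := x
  suffices h2 : Submodule.span K (Set.range fun T : Fin n ≃ Fin m × Fin 2 => flipSum K T) ≤
      U.toSubmodule.map (spechtModule K n (twoRows m)).toSubmodule.subtype by
    rw [← spechtModule_twoRows] at h2
    obtain ⟨y, hy, hyx⟩ := h2 hx
    have : y = ⟨x, hx⟩ := Subtype.ext hyx
    exact this ▸ hy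
  rw [Submodule.span_le]
  rintro _ ⟨T', rfl⟩
  -- This permutation carries the tableau `T` to `T'`.
  refine ⟨_, U.apply_mem_toSubmodule (T.trans T'.symm) h, ?_⟩
  change tabloidRep K n (T.trans T'.symm) (flipSum K T) = _
  rw [tabloidRep_flipSum]
  congr 1
  ext i : 1
  simp

theorem isIrreducible_spechtModule_twoRows [CharZero K] (T : Fin n ≃ Fin m × Fin 2) :
    Representation.IsIrreducible (V := (spechtModule K n (twoRows m)).toSubmodule)
      (spechtModule K n (twoRows m)).toRepresentation := by
  set S := spechtModule K n (twoRows m) with hS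
  let e : S.toSubmodule := ⟨flipSum K T, flipSum_mem_spechtModule T⟩
  let κ : Module.End K S.toSubmodule :=
    ∑ p : Fin m → Fin 2, flipSign K p • S.toRepresentation (flipPerm T p)
  have hκ : ∀ x, (κ x : (Fin n → ℕ) →₀ K) = flipAntisymmetrizer K T x := by
    intro x
    simp only [κ, flipAntisymmetrizer, LinearMap.sum_apply, LinearMap.smul_apply,
      Submodule.coe_sum, Submodule.coe_smul]
    rfl
  refine isIrreducible_of_rank_one (V := S.toSubmodule) S.toRepresentation e ?_ ?_ κ ?_ ?_
    ((2 : K) ^ m) (pow_ne_zero _ two_ne_zero) ?_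
  · exact fun h => flipSum_ne_zero (K := K) T (congrArg Subtype.val h)
  · exact fun U hU => subrepresentation_eq_top_of_flipSum_mem T U hU
  · intro U x hx
    simp only [κ, LinearMap.sum_apply, LinearMap.smul_apply]
    exact sum_mem fun p _ => Submodule.smul_mem _ _ (U.apply_mem_toSubmodule _ hx)
  · intro x
    obtain ⟨a, ha⟩ := Submodule.mem_span_singleton.mp
      (flipAntisymmetrizer_mem_span_of_mem T x.2)
    exact ⟨a, Subtype.ext (by rw [hκ, ← ha]; rfl)⟩
  · exact Subtype.ext (by rw [hκ]; exact flipAntisymmetrizer_flipSum T)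

end TwoRowSpecht

/-! ### Averaging polytabloids over the rearrangements of a row -/

section Averaging

variable {K : Type*} [Field K] {m n : ℕ}

theorem permHom_linearization {ι : Type*} [DecidableEq ι] (σ : Equiv.Perm (Fin n))
    (b : Fin n → ι) (f : FreeAlgebra K ι) :
    permHom K σ (linearization b f) = linearization (b ∘ σ.symm) f := by
  rw [linearization, linearization, ← multilinearPart_permHom]
  congr 1
  suffices h : (permHom K σ).comp
      (FreeAlgebra.lift K fun i => ∑ j with b j = i, FreeAlgebra.ι K j) =
      FreeAlgebra.lift K fun i => ∑ j with (b ∘ σ.symm) j = i, FreeAlgebra.ι K j from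
    DFunLike.congr_fun h f
  ext i
  simp only [Function.comp_apply, AlgHom.coe_comp, FreeAlgebra.lift_ι_apply, map_sum,
    Finset.sum_filter]
  refine Fintype.sum_equiv σ _ _ fun j => ?_
  simp only [Equiv.symm_apply_apply]
  split_ifs <;> simp [permHom]

theorem linearization_incl (r : Fin n → Fin 2) (f : FreeAlgebra K (Fin 2)) :
    linearization (fun i => (r i : ℕ)) (incl K 2 f) = linearization r f := by
  rw [linearization, linearization]
  congr 1
  suffices h : (FreeAlgebra.lift K
      fun s : ℕ => ∑ j with (r j : ℕ) = s, FreeAlgebra.ι K j).comp (incl K 2) =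
      FreeAlgebra.lift K fun s => ∑ j with r j = s, FreeAlgebra.ι K j from DFunLike.congr_fun h f
  ext s
  simp [incl, Fin.val_inj]

theorem exists_perm_comp_eq {α ι : Type*} [Fintype α] [DecidableEq ι] {a b : α → ι}
    (h : ∀ i, Fintype.card {x // b x = i} = Fintype.card {x // a x = i}) :
    ∃ τ : Equiv.Perm α, a ∘ τ = b := by
  let e := fun i => Fintype.equivOfCardEq (h i)
  refine ⟨(Equiv.sigmaFiberEquiv b).symm.trans
    ((Equiv.sigmaCongrRight e).trans (Equiv.sigmaFiberEquiv a)), funext fun x => ?_⟩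
  exact (e (b x) ⟨x, rfl⟩).2

/-- Equal fibre sizes give one solution, and translating by it identifies the set of solutions with
the stabilizer of `a`, a product of symmetric groups on the fibres. -/
theorem card_perm_comp_eq {α ι : Type*} [Fintype α] [DecidableEq α] [Fintype ι] [DecidableEq ι]
    {a b : α → ι} (h : ∀ i, Fintype.card {x // b x = i} = Fintype.card {x // a x = i}) :
    #{τ : Equiv.Perm α | a ∘ τ = b} = ∏ i, (Fintype.card {x // a x = i}).factorial := by
  obtain ⟨τ₀, hτ₀⟩ := exists_perm_comp_eq h
  rw [← DomMulAct.stabilizer_card a, ← Fintype.card_subtype]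
  refine Fintype.card_congr ((Equiv.mulRight τ₀⁻¹).subtypeEquiv fun τ => ?_)
  rw [Equiv.coe_mulRight, Equiv.Perm.coe_mul, ← Function.comp_assoc]
  constructor
  · rintro rfl
    rw [← hτ₀]
    funext x
    simp
  · intro h2
    rw [← hτ₀]
    funext x
    simpa using congrFun h2 (τ₀ x)

theorem card_perm_comp_eq_factorial {a b : Fin m → Fin 2} (h : #{j | b j = 1} = #{j | a j = 1}) :
    #{τ : Equiv.Perm (Fin m) | a ∘ τ = b} =
      (#{j | a j = 1}).factorial * (m - #{j | a j = 1}).factorial := by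
  have h0 : ∀ c : Fin m → Fin 2, #{j | c j = 0} = m - #{j | c j = 1} := by
    intro c
    have h1 := Finset.card_filter_add_card_filter_not (s := univ) (fun j => c j = 1)
    have h2 : ∀ s : Fin 2, ¬ s = 1 ↔ s = 0 := by decide
    simp only [h2, Finset.card_univ, Fintype.card_fin] at h1
    omega
  rw [card_perm_comp_eq]
  · simp only [Fintype.card_subtype, Fin.prod_univ_two, h0]
    rw [mul_comm]
  · intro i
    simp only [Fintype.card_subtype]
    fin_cases i
    · simpa [h0] using by rw [h]
    · exact h

/-- The tableau obtained from `T` by permuting the entries of the second row. -/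
def shiftSecondRow (T : Fin n ≃ Fin m × Fin 2) (τ : Equiv.Perm (Fin m)) : Fin n ≃ Fin m × Fin 2 :=
  T.trans (Equiv.prodCongrLeft fun s : Fin 2 => if s = 0 then 1 else τ)

/-- The first row is not rearranged, so it determines `p`; the second row then becomes a condition
on `τ` alone. Hence the coefficient of a tabloid in the averaged sum is a sign times a number of
permutations. -/
theorem flipRow_shiftSecondRow_eq_iff (T : Fin n ≃ Fin m × Fin 2) (τ : Equiv.Perm (Fin m))
    (p : Fin m → Fin 2) (r : Fin n → Fin 2) :
    flipRow (shiftSecondRow T τ) p = r ↔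
      p = (fun j => r (T.symm (j, 0))) ∧
        (fun j => r (T.symm (j, 0))) ∘ τ = fun j => r (T.symm (j, 1)) + 1 := by
  have h0 : ∀ j, flipRow (shiftSecondRow T τ) p (T.symm (j, 0)) = p j := by
    simp [flipRow, shiftSecondRow]
  have h1 : ∀ j, flipRow (shiftSecondRow T τ) p (T.symm (j, 1)) = p (τ j) + 1 := by
    simp [flipRow, shiftSecondRow]
  have h2 : ∀ a b : Fin 2, a + 1 = b ↔ a = b + 1 := by decide
  have h3 : flipRow (shiftSecondRow T τ) p = r ↔
      (∀ j, p j = r (T.symm (j, 0))) ∧ ∀ j, p (τ j) = r (T.symm (j, 1)) + 1 := by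
    constructor
    · rintro rfl
      exact ⟨fun j => (h0 j).symm, fun j => (h2 _ _).mp (h1 j).symm⟩
    · rintro ⟨h4, h5⟩
      funext i
      obtain ⟨⟨j, s⟩, rfl⟩ := T.symm.surjective i
      have h6 : ∀ s : Fin 2, s = 0 ∨ s = 1 := by decide
      rcases h6 s with rfl | rfl
      · exact (h0 j).trans (h4 j)
      · exact (h1 j).trans ((h2 _ _).mpr (h5 j))
  rw [h3]
  simp only [funext_iff, Function.comp_apply]
  constructor
  · rintro ⟨h4, h5⟩
    exact ⟨h4, fun j => by rw [← h4, h5]⟩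
  · rintro ⟨h4, h5⟩
    exact ⟨h4, fun j => by rw [h4, h5]⟩

theorem flipSign_eq (p : Fin m → Fin 2) : flipSign K p = (-1) ^ #{j | p j = 1} := by
  have h : ∀ s : Fin 2, (-1 : K) ^ (s : ℕ) = if s = 1 then -1 else 1 := by
    intro s
    fin_cases s <;> simp
  simp [flipSign, h, Finset.prod_ite]

theorem card_filter_row (T : Fin n ≃ Fin m × Fin 2) (P : Fin n → Prop) [DecidablePred P]
    (s : Fin 2) : #{i | (T i).2 = s ∧ P i} = #{j | P (T.symm (j, s))} := by
  symm
  refine Finset.card_bij (fun j _ => T.symm (j, s)) ?_ ?_ ?_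
  · intro j hj
    simpa using hj
  · intro j _ k _ h
    simpa using h
  · intro i hi
    simp only [Finset.mem_filter, Finset.mem_univ, true_and] at hi
    have h2 : T.symm ((T i).1, s) = i := by rw [← hi.1]; simp
    exact ⟨(T i).1, by simpa [h2] using hi.2, h2⟩

theorem card_filter_eq_zero (T : Fin n ≃ Fin m × Fin 2) (r : Fin n → Fin 2) :
    #{i | r i = 0} = #{j | r (T.symm (j, 0)) = 0} + #{j | r (T.symm (j, 1)) = 0} := by
  rw [← card_filter_row T (fun i => r i = 0), ← card_filter_row T (fun i => r i = 0),
    ← Finset.card_union_of_disjoint]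
  · congr 1
    ext i
    have h : (T i).2 = 0 ∨ (T i).2 = 1 := by
      generalize (T i).2 = s
      revert s
      decide
    simp only [Finset.mem_filter, Finset.mem_univ, true_and, Finset.mem_union]
    tauto
  · rw [Finset.disjoint_filter]
    rintro i - ⟨h, -⟩ ⟨h', -⟩
    rw [h] at h'
    exact zero_ne_one h'

/-- The sum of the polytabloids of all tableaux with the same rows maps to a nonzero multiple of
the linearization. -/
theorem sum_flipSum_linearization [CharZero K] (T : Fin n ≃ Fin m × Fin 2) :
    ∑ τ : Equiv.Perm (Fin m), ∑ p : Fin m → Fin 2,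
      flipSign K p • linearization (flipRow (shiftSecondRow T τ) p) (commPow K m) =
      ((m + 1).factorial : K) • linearization (fun i => (T i).2) (commPow K m) := by
  set F : (Fin n → Fin 2) → FreeAlgebra K (Fin n) := fun r => linearization r (commPow K m) with hF
  let k : (Fin n → Fin 2) → ℕ := fun r => #{i | (T i).2 = 0 ∧ r i = 1}
  have hk : ∀ r, k r = #{j | r (T.symm (j, 0)) = 1} := fun r =>
    card_filter_row T (fun i => r i = 1) 0
  have h1 : ∑ τ : Equiv.Perm (Fin m), ∑ p : Fin m → Fin 2,
      flipSign K p • F (flipRow (shiftSecondRow T τ) p) =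
      ∑ r, (∑ τ : Equiv.Perm (Fin m), ∑ p : Fin m → Fin 2,
        if flipRow (shiftSecondRow T τ) p = r then flipSign K p else 0) • F r := by
    symm
    simp only [Finset.sum_smul, ite_smul, zero_smul]
    rw [Finset.sum_comm]
    refine Finset.sum_congr rfl fun τ _ => ?_
    rw [Finset.sum_comm]
    refine Finset.sum_congr rfl fun p _ => ?_
    simp
  have h2 : ∀ r, (∑ τ : Equiv.Perm (Fin m), ∑ p : Fin m → Fin 2,
      if flipRow (shiftSecondRow T τ) p = r then flipSign K p else 0) • F r =
      ((-1) ^ k r * ((k r).factorial * (m - k r).factorial : ℕ) : K) • F r := by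
    intro r
    -- The coefficient formula need only hold after multiplication by `F r`, which vanishes for the
    -- wrong row size.
    by_cases hr : #{i | r i = 0} = m
    · congr 1
      simp only [flipRow_shiftSecondRow_eq_iff, ite_and, Finset.sum_ite_eq',
        Finset.mem_univ, if_true]
      rw [← Finset.sum_filter, Finset.sum_const, card_perm_comp_eq_factorial, flipSign_eq, ← hk,
        nsmul_eq_mul, mul_comm]
      -- The permutation count requires as many entries moving up as moving down, which is what row
      -- size `m` says.
      have h3 : ∀ s : Fin 2, s + 1 = 1 ↔ s = 0 := by decide
      simp only [h3]
      have h4 := card_filter_eq_zero T r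
      have h5 := Finset.card_filter_add_card_filter_not (s := univ)
        (fun j => r (T.symm (j, 0)) = 1)
      have h6 : ∀ s : Fin 2, ¬ s = 1 ↔ s = 0 := by decide
      simp only [h6, Finset.card_univ, Fintype.card_fin] at h5
      omega
    · simp [hF, linearization_commPow_of_card_ne hr]
  have h3 := sum_eq_choose_smul_of_forall F k (F fun i => (T i).2) m
    (sum_pow_smul_linearization_commPow m fun i => (T i).2)
  have hkm : ∀ r, k r ∈ Finset.range (m + 1) := by
    intro r
    rw [Finset.mem_range, Nat.lt_succ_iff, hk]
    exact (Finset.card_le_univ _).trans_eq (Fintype.card_fin m)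
  rw [h1, Finset.sum_congr rfl fun r _ => h2 r,
    ← Finset.sum_fiberwise_of_maps_to (fun r _ => hkm r)]
  -- Since j! (m - j)! C(m, j) = m! and the two signs cancel, every j contributes the same amount;
  -- the `m + 1` values of j then give (m + 1)!.
  have h4 : ∀ j ∈ Finset.range (m + 1), ∑ r with k r = j,
      ((-1) ^ k r * ((k r).factorial * (m - k r).factorial : ℕ) : K) • F r =
      (m.factorial : K) • F fun i => (T i).2 := by
    intro j hj
    have h5 : ∀ r ∈ ({r | k r = j} : Finset (Fin n → Fin 2)),
        ((-1) ^ k r * ((k r).factorial * (m - k r).factorial : ℕ) : K) • F r =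
        ((-1) ^ j * (j.factorial * (m - j).factorial : ℕ) : K) • F r := by
      intro r hr
      rw [(Finset.mem_filter.mp hr).2]
    rw [Finset.sum_congr rfl h5, ← Finset.smul_sum, h3, smul_smul]
    congr 1
    have h6 : ((-1 : K) ^ j) * (-1) ^ j = 1 := by rw [← mul_pow]; simp
    rw [← Nat.choose_mul_factorial_mul_factorial (Nat.lt_succ_iff.mp (Finset.mem_range.mp hj))]
    push_cast
    linear_combination (m.choose j * j.factorial * (m - j).factorial : K) * h6
  rw [Finset.sum_congr rfl h4, Finset.sum_const, Finset.card_range, ← Nat.cast_smul_eq_nsmul K,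
    smul_smul, Nat.factorial_succ]
  push_cast
  rfl

end Averaging

/-! ### Lie nilpotency and evaluation on generators of Grassmann type -/

section GrassmannGenerators

variable {K A : Type*} [Field K] [Ring A] [Algebra K A] {m n : ℕ}

/-- The relations between the generators of a tensor power of the Grassmann algebra `E_2`. -/
structure IsGrassmannFamily (g : Fin m × Fin 2 → A) : Prop where
  mul_self : ∀ x, g x * g x = 0
  comm : ∀ x y, x.1 ≠ y.1 → g x * g y = g y * g x
  anticomm : ∀ j, g (j, 1) * g (j, 0) = -(g (j, 0) * g (j, 1))

/-- The product of the two generators of the `j`-th factor. -/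
def socle (g : Fin m × Fin 2 → A) (j : Fin m) : A := g (j, 0) * g (j, 1)

/-- A repeated factor can be moved, up to sign, next to its other occurrence, where its square
vanishes. -/
theorem prod_eq_zero_of_not_nodup {ι : Type*} {x : ι → A} (hsq : ∀ i, x i * x i = 0)
    (hcomm : ∀ i j, x i * x j = x j * x i ∨ x i * x j = -(x j * x i)) {l : List ι}
    (hl : ¬ l.Nodup) : (l.map x).prod = 0 := by
  have h : ∀ (a : ι) (l : List ι), a ∈ l → x a * (l.map x).prod = 0 := by
    intro a l
    induction l with
    | nil => simp
    | cons b l ih =>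
      intro hab
      rw [List.map_cons, List.prod_cons, ← mul_assoc]
      rcases List.mem_cons.mp hab with rfl | hab
      · rw [hsq, zero_mul]
      · rcases hcomm a b with h | h
        · rw [h, mul_assoc, ih hab, mul_zero]
        · rw [h, neg_mul, mul_assoc, ih hab, mul_zero, neg_zero]
  induction l with
  | nil => simp at hl
  | cons a l ih =>
    rw [List.map_cons, List.prod_cons]
    by_cases ha : a ∈ l
    · exact h a l ha
    · rw [ih (fun h => hl (List.nodup_cons.mpr ⟨ha, h⟩)), mul_zero]

namespace IsGrassmannFamily

variable {g : Fin m × Fin 2 → A} (hg : IsGrassmannFamily g)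
include hg

theorem comm_or_anticomm (x y : Fin m × Fin 2) :
    g x * g y = g y * g x ∨ g x * g y = -(g y * g x) := by
  by_cases h : x.1 = y.1
  · obtain ⟨j, s⟩ := x
    obtain ⟨k, t⟩ := y
    obtain rfl : j = k := h
    have h2 : ∀ s : Fin 2, s = 0 ∨ s = 1 := by decide
    rcases h2 s with rfl | rfl <;> rcases h2 t with rfl | rfl
    · exact Or.inl rfl
    · exact Or.inr (by rw [hg.anticomm, neg_neg])
    · exact Or.inr (hg.anticomm j)
    · exact Or.inl rfl
  · exact Or.inl (hg.comm x y h)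

theorem commute_socle (j : Fin m) (x : Fin m × Fin 2) : Commute (socle g j) (g x) := by
  by_cases h : j = x.1
  · obtain ⟨k, s⟩ := x
    obtain rfl : j = k := h
    have h2 : ∀ s : Fin 2, s = 0 ∨ s = 1 := by decide
    have h3 := hg.mul_self (j, 0)
    have h4 := hg.mul_self (j, 1)
    rcases h2 s with rfl | rfl
    · rw [Commute, SemiconjBy, socle, mul_assoc, hg.anticomm, mul_neg, ← mul_assoc, h3]
      simp
    · rw [Commute, SemiconjBy, socle, ← mul_assoc, hg.anticomm, neg_mul, mul_assoc, h4]
      simp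
  · exact Commute.mul_left (hg.comm (j, 0) x h) (hg.comm (j, 1) x h)

theorem commute_socle_socle (j k : Fin m) : Commute (socle g j) (socle g k) :=
  (hg.commute_socle j _).mul_right (hg.commute_socle j _)

theorem socle_mul_self (j : Fin m) : socle g j * socle g j = 0 := by
  calc socle g j * socle g j = socle g j * g (j, 0) * g (j, 1) := by
        rw [mul_assoc]
        rfl
    _ = g (j, 0) * g (j, 0) * g (j, 1) * g (j, 1) := by
        rw [(hg.commute_socle j (j, 0)).eq, socle, ← mul_assoc (g (j, 0))]
    _ = 0 := by rw [hg.mul_self, zero_mul, zero_mul]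

theorem commute_prod_socle (l : List (Fin m)) {u : A} (hu : u ∈ Algebra.adjoin K (Set.range g)) :
    Commute (l.map (socle g)).prod u := by
  suffices h : Algebra.adjoin K (Set.range g) ≤
      Subalgebra.centralizer K {(l.map (socle g)).prod} from
    (Subalgebra.mem_centralizer_iff K).mp (h hu) _ rfl
  refine Algebra.adjoin_le ?_
  rintro _ ⟨x, rfl⟩
  refine (Subalgebra.mem_centralizer_iff K).mpr ?_
  rintro _ rfl
  refine Commute.list_prod_left _ _ fun a ha => ?_
  obtain ⟨j, -, rfl⟩ := List.mem_map.mp ha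
  exact hg.commute_socle j x

end IsGrassmannFamily

/-- The ideal of the algebra generated by `g` spanned by the multiples of the products of `k`
elements of the form `socle g j`. -/
def soclePower (K : Type*) [Field K] [Algebra K A] (g : Fin m × Fin 2 → A) (k : ℕ) :
    Submodule K A :=
  Submodule.span K {a | ∃ l : List (Fin m), l.length = k ∧
    ∃ u ∈ Algebra.adjoin K (Set.range g), a = (l.map (socle g)).prod * u}

namespace IsGrassmannFamily

variable {g : Fin m × Fin 2 → A} (hg : IsGrassmannFamily g)

theorem mul_mem_soclePower {k : ℕ} {a u : A} (ha : a ∈ soclePower K g k)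
    (hu : u ∈ Algebra.adjoin K (Set.range g)) : a * u ∈ soclePower K g k := by
  induction ha using Submodule.span_induction with
  | mem a h =>
    obtain ⟨l, hl, v, hv, rfl⟩ := h
    rw [mul_assoc]
    exact Submodule.subset_span ⟨l, hl, _, mul_mem hv hu, rfl⟩
  | zero => simp
  | add a b _ _ ha hb => rw [add_mul]; exact add_mem ha hb
  | smul c a _ ha => rw [smul_mul_assoc]; exact Submodule.smul_mem _ _ ha

theorem prod_socle_mul_mem {k : ℕ} {a : A} (l : List (Fin m)) (ha : a ∈ soclePower K g k) :
    (l.map (socle g)).prod * a ∈ soclePower K g (l.length + k) := by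
  induction ha using Submodule.span_induction with
  | mem a h =>
    obtain ⟨l', hl, v, hv, rfl⟩ := h
    rw [← mul_assoc, ← List.prod_append, ← List.map_append]
    exact Submodule.subset_span ⟨l ++ l', by simp [hl], _, hv, rfl⟩
  | zero => simp
  | add a b _ _ ha hb => rw [mul_add]; exact add_mem ha hb
  | smul c a _ ha => rw [mul_smul_comm]; exact Submodule.smul_mem _ _ ha

include hg

theorem mul_mem_soclePower_left {k : ℕ} {a u : A} (ha : a ∈ soclePower K g k)
    (hu : u ∈ Algebra.adjoin K (Set.range g)) : u * a ∈ soclePower K g k := by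
  induction ha using Submodule.span_induction with
  | mem a h =>
    obtain ⟨l, hl, v, hv, rfl⟩ := h
    rw [← mul_assoc, ← (hg.commute_prod_socle l hu).eq, mul_assoc]
    exact Submodule.subset_span ⟨l, hl, _, mul_mem hu hv, rfl⟩
  | zero => simp
  | add a b _ _ ha hb => rw [mul_add]; exact add_mem ha hb
  | smul c a _ ha => rw [mul_smul_comm]; exact Submodule.smul_mem _ _ ha

theorem lie_generators (x y : Fin m × Fin 2) :
    ⁅g x, g y⁆ ∈ soclePower K g 1 := by
  have hs : ∀ j, socle g j ∈ soclePower K g 1 := fun j =>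
    Submodule.subset_span ⟨[j], rfl, 1, one_mem _, by simp⟩
  rw [Ring.lie_def]
  by_cases h : x.1 = y.1
  · obtain ⟨j, s⟩ := x
    obtain ⟨k, t⟩ := y
    obtain rfl : j = k := h
    have h2 : ∀ s : Fin 2, s = 0 ∨ s = 1 := by decide
    rcases h2 s with rfl | rfl <;> rcases h2 t with rfl | rfl
    · simp
    · rw [hg.anticomm, sub_neg_eq_add]
      exact add_mem (hs j) (hs j)
    · rw [hg.anticomm]
      exact sub_mem (neg_mem (hs j)) (hs j)
    · simp
  · rw [hg.comm x y h, sub_self]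
    exact zero_mem _

/-- The bracket is a derivation in each argument and `soclePower K g 1` absorbs multiplication on
both sides, so it suffices to bracket generators. -/
theorem lie_mem_soclePower_one {u v : A} (hu : u ∈ Algebra.adjoin K (Set.range g))
    (hv : v ∈ Algebra.adjoin K (Set.range g)) : ⁅u, v⁆ ∈ soclePower K g 1 := by
  induction hu, hv using Algebra.adjoin_induction₂ with
  | mem_mem x y hx hy =>
    obtain ⟨x, rfl⟩ := hx
    obtain ⟨y, rfl⟩ := hy
    exact hg.lie_generators x y
  | algebraMap_both r s => simp [Ring.lie_def, ← map_mul, mul_comm]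
  | algebraMap_left r x hx => simp [Ring.lie_def, Algebra.commutes]
  | algebraMap_right r x hx => simp [Ring.lie_def, Algebra.commutes]
  | add_left x y z _ _ _ h1 h2 =>
    have h : ⁅x + y, z⁆ = ⁅x, z⁆ + ⁅y, z⁆ := by
      simp only [Ring.lie_def]
      noncomm_ring
    rw [h]
    exact add_mem h1 h2
  | add_right x y z _ _ _ h1 h2 =>
    have h : ⁅x, y + z⁆ = ⁅x, y⁆ + ⁅x, z⁆ := by
      simp only [Ring.lie_def]
      noncomm_ring
    rw [h]
    exact add_mem h1 h2
  | mul_left x y z hx hy hz h1 h2 =>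
    have h : ⁅x * y, z⁆ = x * ⁅y, z⁆ + ⁅x, z⁆ * y := by
      simp only [Ring.lie_def]
      noncomm_ring
    rw [h]
    exact add_mem (hg.mul_mem_soclePower_left h2 hx) (mul_mem_soclePower h1 hy)
  | mul_right x y z hx hy hz h1 h2 =>
    have h : ⁅x, y * z⁆ = ⁅x, y⁆ * z + y * ⁅x, z⁆ := by
      simp only [Ring.lie_def]
      noncomm_ring
    rw [h]
    exact add_mem (mul_mem_soclePower h1 hz) (hg.mul_mem_soclePower_left h2 hy)

/-- The socle factors commute with `v` and come out of the bracket; the remaining bracket provides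
one further socle factor. -/
theorem lie_mem_soclePower {k : ℕ} {a v : A} (ha : a ∈ soclePower K g k)
    (hv : v ∈ Algebra.adjoin K (Set.range g)) : ⁅a, v⁆ ∈ soclePower K g (k + 1) := by
  induction ha using Submodule.span_induction with
  | mem a h =>
    obtain ⟨l, rfl, u, hu, rfl⟩ := h
    have h : ⁅(l.map (socle g)).prod * u, v⁆ = (l.map (socle g)).prod * ⁅u, v⁆ := by
      rw [Ring.lie_def, Ring.lie_def, ← mul_assoc, ← (hg.commute_prod_socle l hv).eq, mul_sub]
      simp only [mul_assoc]
    rw [h]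
    exact prod_socle_mul_mem l (hg.lie_mem_soclePower_one hu hv)
  | zero => simp [Ring.lie_def]
  | add a b _ _ ha hb =>
    have h : ⁅a + b, v⁆ = ⁅a, v⁆ + ⁅b, v⁆ := by
      simp only [Ring.lie_def]
      noncomm_ring
    rw [h]
    exact add_mem ha hb
  | smul c a _ ha => rw [Ring.lie_def, smul_mul_assoc, mul_smul_comm, ← smul_sub,
      ← Ring.lie_def]; exact Submodule.smul_mem _ _ ha

theorem leftNormed_mem_soclePower {k : ℕ} {a : A} (ha : a ∈ soclePower K g k) (v : List A)
    (hv : ∀ x ∈ v, x ∈ Algebra.adjoin K (Set.range g)) :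
    leftNormed a v ∈ soclePower K g (k + v.length) := by
  induction v generalizing a k with
  | nil => exact ha
  | cons b v ih =>
    have h := ih (hg.lie_mem_soclePower ha (hv b List.mem_cons_self))
      fun x hx => hv x (List.mem_cons_of_mem _ hx)
    rw [add_assoc, add_comm 1] at h
    exact h

/-- Among `m + 1` socle factors two have the same index, and socle elements commute and square to
zero. -/
theorem soclePower_succ_eq_bot : soclePower K g (m + 1) = ⊥ := by
  rw [soclePower, Submodule.span_eq_bot]
  rintro _ ⟨l, hl, u, -, rfl⟩
  rw [prod_eq_zero_of_not_nodup hg.socle_mul_self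
    (fun i j => Or.inl (hg.commute_socle_socle i j).eq), zero_mul]
  intro h
  have := h.length_le_card
  simp [hl] at this

/-- A commutator of length `m + 2` involves `m + 1` brackets, each raising the socle power by one.
-/
theorem map_commutatorIdeal_eq_zero (φ : FreeAlgebra K ℕ →ₐ[K] A)
    (hφ : ∀ i, φ (FreeAlgebra.ι K i) ∈ Algebra.adjoin K (Set.range g)) {f : FreeAlgebra K ℕ}
    (hf : f ∈ commutatorIdeal K (m + 2)) : φ f = 0 := by
  have hφ' : ∀ f, φ f ∈ Algebra.adjoin K (Set.range g) := by
    intro f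
    induction f using FreeAlgebra.induction with
    | grade0 r => rw [AlgHom.commutes]; exact Subalgebra.algebraMap_mem _ r
    | grade1 i => exact hφ i
    | mul a b ha hb => rw [map_mul]; exact mul_mem ha hb
    | add a b ha hb => rw [map_add]; exact add_mem ha hb
  have h : commutatorIdeal K (m + 2) ≤ TwoSidedIdeal.ker (φ : FreeAlgebra K ℕ →+* A) := by
    refine TwoSidedIdeal.span_le.mpr ?_
    rintro w ⟨u, v, hv, rfl⟩
    refine (TwoSidedIdeal.mem_ker _).mpr ?_
    change φ _ = 0
    rw [map_leftNormed]
    have h0 : φ u ∈ soclePower K g 0 :=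
      Submodule.subset_span ⟨[], rfl, φ u, hφ' u, by simp⟩
    have h1 := hg.leftNormed_mem_soclePower h0 (v.map φ) (by
      intro x hx
      obtain ⟨y, -, rfl⟩ := List.mem_map.mp hx
      exact hφ' y)
    have h2 : 0 + (v.map φ).length = m + 1 := by
      rw [List.length_map]
      omega
    rw [h2, hg.soclePower_succ_eq_bot] at h1
    exact (Submodule.mem_bot K).mp h1
  exact (TwoSidedIdeal.mem_ker _).mp (h hf)

theorem lift_relIdeal_eq_zero (T : Fin n → Fin m × Fin 2) {f : FreeAlgebra K (Fin n)}
    (hf : f ∈ relIdeal K (m + 1) n) : FreeAlgebra.lift K (fun i => g (T i)) f = 0 := by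
  let φ : FreeAlgebra K ℕ →ₐ[K] A :=
    -- The value 0 at the other variables is immaterial, as they do not occur in the image of `incl
    -- K n`.
    FreeAlgebra.lift K fun i => if h : i < n then g (T ⟨i, h⟩) else 0
  have h : FreeAlgebra.lift K (fun i => g (T i)) = φ.comp (incl K n) := by
    ext i
    simp [incl, φ]
  rw [h]
  refine hg.map_commutatorIdeal_eq_zero φ (fun i => ?_) ((TwoSidedIdeal.mem_comap _).mp hf)
  simp only [φ, FreeAlgebra.lift_ι_apply]
  split_ifs
  · exact Algebra.subset_adjoin ⟨_, rfl⟩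
  · exact zero_mem _

end IsGrassmannFamily

/-- The polynomials of degree `d`. -/
def homogeneousPart (K : Type*) [Field K] (X : Type*) (d : ℕ) : Submodule K (FreeAlgebra K X) :=
  Submodule.span K {f | ∃ w : List X, w.length = d ∧ f = (w.map (FreeAlgebra.ι K)).prod}

theorem mul_mem_homogeneousPart {X : Type*} {d e : ℕ} {f h : FreeAlgebra K X}
    (hf : f ∈ homogeneousPart K X d) (hh : h ∈ homogeneousPart K X e) :
    f * h ∈ homogeneousPart K X (d + e) := by
  have h := Submodule.mul_mem_mul hf hh
  rw [homogeneousPart, homogeneousPart, Submodule.span_mul_span] at h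
  refine Submodule.span_mono ?_ h
  rintro _ ⟨_, ⟨v, rfl, rfl⟩, _, ⟨w, rfl, rfl⟩, rfl⟩
  exact ⟨v ++ w, by simp, by simp⟩

theorem pow_mem_homogeneousPart {X : Type*} {d : ℕ} {f : FreeAlgebra K X}
    (hf : f ∈ homogeneousPart K X d) (k : ℕ) : f ^ k ∈ homogeneousPart K X (k * d) := by
  induction k with
  | zero => exact Submodule.subset_span ⟨[], by simp, by simp⟩
  | succ k ih =>
    rw [pow_succ, Nat.succ_mul]
    exact mul_mem_homogeneousPart ih hf

theorem add_pow_succ_of_mul_self_eq_zero {a s : A} (h : Commute a s) (ha : a * a = 0) (k : ℕ) :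
    (a + s) ^ (k + 1) = s ^ (k + 1) + (k + 1) • (a * s ^ k) := by
  induction k with
  | zero => simp [add_comm]
  | succ k ih =>
    rw [pow_succ', ih, add_mul, mul_add, mul_add, mul_smul_comm, mul_smul_comm, ← mul_assoc a a,
      ha, ← mul_assoc s a, ← h.eq, mul_assoc a s, ← pow_succ', ← pow_succ', zero_mul, smul_zero,
      add_zero, succ_nsmul _ (k + 1)]
    abel

/-- Only the squarefree term of the multinomial expansion survives. The vanishing of the next power
is carried along because the inductive step for the first claim uses it. -/
theorem sum_pow_length {ι : Type*} {w : ι → A} (hcomm : ∀ i j, Commute (w i) (w j))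
    (hsq : ∀ i, w i * w i = 0) (l : List ι) :
    (l.map w).sum ^ l.length = l.length.factorial • (l.map w).prod ∧
      (l.map w).sum ^ (l.length + 1) = 0 := by
  induction l with
  | nil => simp
  | cons a l ih =>
    obtain ⟨h1, h2⟩ := ih
    have hc : Commute (w a) (l.map w).sum := by
      refine Commute.list_sum_right _ _ fun x hx => ?_
      obtain ⟨i, -, rfl⟩ := List.mem_map.mp hx
      exact hcomm a i
    simp only [List.map_cons, List.sum_cons, List.prod_cons, List.length_cons]
    rw [add_pow_succ_of_mul_self_eq_zero hc (hsq a), add_pow_succ_of_mul_self_eq_zero hc (hsq a),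
      pow_succ _ (l.length + 1), h2, h1, Nat.factorial_succ, mul_smul_comm, smul_smul]
    simp

namespace IsGrassmannFamily

variable {g : Fin m × Fin 2 → A} (hg : IsGrassmannFamily g)
include hg

theorem lie_sum_sum : ⁅∑ j, g (j, 0), ∑ j, g (j, 1)⁆ = (2 : K) • ∑ j, socle g j := by
  rw [Finset.smul_sum, Ring.lie_def, Finset.sum_mul_sum, Finset.sum_mul_sum,
    Finset.sum_comm (f := fun i j => g (i, 1) * g (j, 0)), ← Finset.sum_sub_distrib]
  refine Finset.sum_congr rfl fun j _ => ?_
  rw [← Finset.sum_sub_distrib, Finset.sum_eq_single j]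
  · rw [hg.anticomm, sub_neg_eq_add, two_smul]
    rfl
  · intro k _ hk
    rw [hg.comm (j, 0) (k, 1) hk.symm, sub_self]
  · simp

theorem lie_sum_sum_pow : ⁅∑ j, g (j, 0), ∑ j, g (j, 1)⁆ ^ m =
    ((2 : K) ^ m * (m.factorial : K)) • ((List.finRange m).map (socle g)).prod := by
  have h := (sum_pow_length hg.commute_socle_socle hg.socle_mul_self (List.finRange m)).1
  rw [List.length_finRange] at h
  have h2 : ((List.finRange m).map (socle g)).sum = ∑ j, socle g j := by
    rw [← List.ofFn_eq_map, List.sum_ofFn]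
  rw [hg.lie_sum_sum (K := K), smul_pow, ← h2, h, ← Nat.cast_smul_eq_nsmul K, smul_smul]

/-- A word of length `n` in `n` variables that is not multilinear repeats a letter, so it evaluates
to zero. Taking the multilinear part is therefore invisible to this evaluation, which allows [x,
y]^m to be evaluated directly. -/
theorem lift_multilinearPart (T : Fin n ≃ Fin m × Fin 2) {f : FreeAlgebra K (Fin n)}
    (hf : f ∈ homogeneousPart K (Fin n) n) :
    FreeAlgebra.lift K (fun i => g (T i)) (multilinearPart K n f) =
      FreeAlgebra.lift K (fun i => g (T i)) f := by
  induction hf using Submodule.span_induction with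
  | mem f h =>
    obtain ⟨w, hw, rfl⟩ := h
    rw [multilinearPart_word]
    split_ifs with hc
    · rfl
    · have hn : ¬ w.Nodup := by
        intro hn
        refine hc fun i => List.count_eq_one_of_mem hn ?_
        have h2 : w.toFinset = univ := by
          rw [← Finset.card_eq_iff_eq_univ, List.toFinset_card_of_nodup hn, hw, Fintype.card_fin]
        rw [← List.mem_toFinset, h2]
        exact Finset.mem_univ i
      rw [map_zero, map_list_prod, List.map_map]
      simp only [Function.comp_def, FreeAlgebra.lift_ι_apply]
      exact (prod_eq_zero_of_not_nodup (fun i => hg.mul_self _)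
        (fun i j => hg.comm_or_anticomm _ _) hn).symm
  | zero => simp
  | add a b _ _ ha hb => rw [map_add, map_add, ha, hb, map_add]
  | smul c a _ ha => rw [map_smul, map_smul, ha, map_smul]

theorem lift_linearization_commPow (T : Fin n ≃ Fin m × Fin 2) :
    FreeAlgebra.lift K (fun i => g (T i)) (linearization (fun i => (T i).2) (commPow K m)) =
      ((2 : K) ^ m * (m.factorial : K)) • ((List.finRange m).map (socle g)).prod := by
  have hι : ∀ s : Fin 2, ∑ i with (T i).2 = s, FreeAlgebra.ι K i ∈
      homogeneousPart K (Fin n) 1 :=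
    fun s => sum_mem fun i _ => Submodule.subset_span ⟨[i], rfl, by simp⟩
  have hn : m * (1 + 1) = n := by simpa using (Fintype.card_congr T).symm
  rw [linearization, lift_commPow, hg.lift_multilinearPart, map_pow, ← hg.lie_sum_sum_pow]
  · have h : ∀ s : Fin 2, FreeAlgebra.lift K (fun i => g (T i))
        (∑ i with (T i).2 = s, FreeAlgebra.ι K i) = ∑ j, g (j, s) := by
      intro s
      simp only [map_sum, FreeAlgebra.lift_ι_apply]
      symm
      refine Finset.sum_bij (fun j _ => T.symm (j, s)) ?_ ?_ ?_ ?_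
      · simp
      · intro j _ k _ h
        simpa using h
      · intro i hi
        simp only [Finset.mem_filter, Finset.mem_univ, true_and] at hi
        exact ⟨(T i).1, Finset.mem_univ _, by rw [← hi]; simp⟩
      · simp
    simp only [Ring.lie_def, map_sub, map_mul, h]
  · have h := pow_mem_homogeneousPart (sub_mem (mul_mem_homogeneousPart (hι 0) (hι 1))
      (mul_mem_homogeneousPart (hι 1) (hι 0))) m
    rwa [hn] at h

end IsGrassmannFamily

end GrassmannGenerators

/-! ### Generators of the tensor power of E_2 and the nonzero top product -/

section GrassmannPower

variable (K : Type*) [Field K]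

/-- The generators of the tensor power of the Grassmann algebra `E_2`. -/
def grassmannGenerator (m : ℕ) (x : Fin m × Fin 2) : GrassmannPower K 2 m :=
  PiTensorProduct.singleAlgHom x.1 (ExteriorAlgebra.ι K (Pi.single x.2 (1 : K)))

theorem isGrassmannFamily_grassmannGenerator (m : ℕ) :
    IsGrassmannFamily (grassmannGenerator K m) where
  mul_self x := by
    rw [grassmannGenerator, ← map_mul, ExteriorAlgebra.ι_sq_zero, map_zero]
  comm x y h := by
    change PiTensorProduct.tprod K _ * PiTensorProduct.tprod K _ =
      PiTensorProduct.tprod K _ * PiTensorProduct.tprod K _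
    rw [PiTensorProduct.tprod_mul_tprod, PiTensorProduct.tprod_mul_tprod]
    exact congrArg _ (Pi.mulSingle_commute h _ _).eq
  anticomm j := by
    refine eq_neg_of_add_eq_zero_left ?_
    simp only [grassmannGenerator]
    rw [← map_mul (PiTensorProduct.singleAlgHom j), ← map_mul (PiTensorProduct.singleAlgHom j),
      ← map_add, ExteriorAlgebra.ι_add_mul_swap, map_zero]

theorem grassmann_ι_mul_ι_ne_zero : ∃ φ : Grassmann K 2 →ₗ[K] K,
    φ (ExteriorAlgebra.ι K (Pi.single 0 (1 : K)) * ExteriorAlgebra.ι K (Pi.single 1 (1 : K))) = 1 := by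
  -- The functional is the determinant in degree 2 and zero in all other degrees.
  refine ⟨ExteriorAlgebra.liftAlternating fun i =>
    if h : i = 2 then h ▸ Matrix.detRowAlternating (n := Fin 2) (R := K) else 0, ?_⟩
  have h : ExteriorAlgebra.ι K (Pi.single 0 (1 : K)) * ExteriorAlgebra.ι K (Pi.single 1 (1 : K)) =
      ExteriorAlgebra.ιMulti K 2 fun s : Fin 2 => (Pi.single s (1 : K) : Fin 2 → K) := by
    rw [ExteriorAlgebra.ιMulti_apply, List.ofFn_succ, List.ofFn_succ, List.ofFn_zero]
    simp only [List.prod_cons, List.prod_nil, mul_one]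
    rfl
  rw [h, ExteriorAlgebra.liftAlternating_apply_ιMulti]
  have h2 : Matrix.of (fun s : Fin 2 => (Pi.single s (1 : K) : Fin 2 → K)) = 1 := by
    ext s t
    simp [Matrix.one_apply, Pi.single_apply, eq_comm]
  exact (congrArg Matrix.det h2).trans Matrix.det_one

theorem prod_socle_grassmannGenerator_ne_zero (m : ℕ) :
    ((List.finRange m).map (socle (grassmannGenerator K m))).prod ≠ 0 := by
  obtain ⟨φ, hφ⟩ := grassmann_ι_mul_ι_ne_zero K
  set z : Grassmann K 2 :=
    ExteriorAlgebra.ι K (Pi.single 0 (1 : K)) * ExteriorAlgebra.ι K (Pi.single 1 (1 : K)) with hz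
  have h : ∀ l : List (Fin m), (l.map (socle (grassmannGenerator K m))).prod =
      PiTensorProduct.tprod K fun i => z ^ l.count i := by
    intro l
    induction l with
    | nil => simp; rfl
    | cons j l ih =>
      have hs : socle (grassmannGenerator K m) j = PiTensorProduct.tprod K (Pi.mulSingle j z) := by
        rw [socle, grassmannGenerator, grassmannGenerator, ← map_mul]
        rfl
      rw [List.map_cons, List.prod_cons, ih, hs, PiTensorProduct.tprod_mul_tprod]
      congr 1
      funext i
      rw [Pi.mul_apply, List.count_cons]
      by_cases hij : j = i
      · subst hij
        simp [pow_succ']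
      · simp [hij]
  have h1 : ∀ i : Fin m, (List.finRange m).count i = 1 := fun i =>
    List.count_eq_one_of_mem (List.nodup_finRange m) (List.mem_finRange i)
  rw [h]
  simp only [h1, pow_one]
  intro h0
  -- The product of the socle elements is the pure tensor z ⊗ ⋯ ⊗ z, on which φ ⊗ ⋯ ⊗ φ takes the
  -- value 1.
  have h2 := congrArg
    (PiTensorProduct.lift ((MultilinearMap.mkPiAlgebra K (Fin m) K).compLinearMap fun _ => φ)) h0
  simp [hφ] at h2

end GrassmannPower

/-! ### The map from tabloids to the relatively free algebra and the isomorphism -/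

section Main

variable {K : Type*} [Field K] {m n : ℕ}

theorem lift_linearization_grassmannGenerator_ne_zero [CharZero K] (T : Fin n ≃ Fin m × Fin 2) :
    FreeAlgebra.lift K (fun i => grassmannGenerator K m (T i))
      (linearization (fun i => (T i).2) (commPow K m)) ≠ 0 := by
  rw [(isGrassmannFamily_grassmannGenerator K m).lift_linearization_commPow]
  exact smul_ne_zero (mul_ne_zero (pow_ne_zero _ two_ne_zero)
    (Nat.cast_ne_zero.mpr m.factorial_ne_zero)) (prod_socle_grassmannGenerator_ne_zero K m)

theorem not_isIdentity_linearization [CharZero K] (T : Fin n ≃ Fin m × Fin 2) :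
    ¬ IsIdentity (linearization (fun i => (T i).2) (commPow K m)) (GrassmannPower K 2 m) :=
  fun h => lift_linearization_grassmannGenerator_ne_zero T (h _)

theorem not_isIdentity_commPow [CharZero K] :
    ¬ IsIdentity (commPow K m) (GrassmannPower K 2 m) := by
  intro h
  have h2 := h fun s => ∑ j, grassmannGenerator K m (j, s)
  rw [lift_commPow, (isGrassmannFamily_grassmannGenerator K m).lie_sum_sum_pow (K := K)] at h2
  exact smul_ne_zero (mul_ne_zero (pow_ne_zero _ two_ne_zero)
    (Nat.cast_ne_zero.mpr m.factorial_ne_zero)) (prod_socle_grassmannGenerator_ne_zero K m) h2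

/-- The evaluation at the Grassmann generators kills the ideal defining the relatively free algebra,
but not the linearization. -/
theorem toRelFree_linearization_ne_zero [CharZero K] (T : Fin n ≃ Fin m × Fin 2) :
    toRelFree K (m + 1) n (linearization (fun i => (T i).2) (commPow K m)) ≠ 0 := by
  intro h
  rw [← map_zero (toRelFree K (m + 1) n)] at h
  have h2 := ((relIdeal K (m + 1) n).rel_iff _ _).mp ((RingCon.eq _).mp h)
  rw [sub_zero] at h2
  exact lift_linearization_grassmannGenerator_ne_zero T
    ((isGrassmannFamily_grassmannGenerator K m).lift_relIdeal_eq_zero T h2)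

theorem linearization_commPow_mem_properMultilinear (r : Fin n → Fin 2) :
    linearization r (commPow K m) ∈ properMultilinear K n := by
  refine ⟨multilinearPart_mem_multilinear _, multilinearPart_mem_proper ?_⟩
  rw [lift_commPow]
  refine pow_mem ?_ m
  have h : ⁅∑ i with r i = 0, FreeAlgebra.ι K i, ∑ i with r i = 1, FreeAlgebra.ι K i⁆ =
      ∑ i with r i = 0, ∑ j with r j = 1, ⁅FreeAlgebra.ι K i, FreeAlgebra.ι K j⁆ := by
    simp only [Ring.lie_def, Finset.sum_sub_distrib]
    rw [Finset.sum_mul_sum, Finset.sum_mul_sum, Finset.sum_comm (s := {j | r j = 1})]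
  rw [h]
  exact sum_mem fun i _ => sum_mem fun j _ =>
    Algebra.subset_adjoin ⟨i, [j], by simp, rfl⟩

/-- The homomorphism from the permutation module on tabloids to `F_n(𝔑_p)` that maps a tabloid
with rows `X` and `Y` to the multilinear part of `[∑ X, ∑ Y]^m`. -/
def tabloidMap (K : Type*) [Field K] (p m n : ℕ) : ((Fin n → ℕ) →₀ K) →ₗ[K] RelFree K p n :=
  Finsupp.linearCombination K fun r =>
    -- Tabloids here may use any row index in ℕ. A variable in a row of index at least 2 is never
    -- substituted, so the multilinear part is then zero.
    toRelFree K p n (linearization r (incl K 2 (commPow K m)))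

theorem tabloidMap_single (p : ℕ) (r : Fin n → Fin 2) :
    tabloidMap K p m n (Finsupp.single (fun i => (r i : ℕ)) 1) =
      toRelFree K p n (linearization r (commPow K m)) := by
  rw [tabloidMap, Finsupp.linearCombination_single, one_smul, linearization_incl]

theorem tabloidMap_tabloidRep (p : ℕ) (σ : Equiv.Perm (Fin n)) (v : (Fin n → ℕ) →₀ K) :
    tabloidMap K p m n (tabloidRep K n σ v) = relFreeRep K p n σ (tabloidMap K p m n v) := by
  suffices h : tabloidMap K p m n ∘ₗ tabloidRep K n σ =
      relFreeRep K p n σ ∘ₗ tabloidMap K p m n from LinearMap.congr_fun h v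
  ext r
  simp only [LinearMap.comp_apply, Finsupp.lsingle_apply, tabloidRep_single, tabloidMap,
    Finsupp.linearCombination_single, one_smul]
  rw [← permHom_linearization, ← relPermHom_toRelFree]
  rfl

theorem exists_mem_spechtModule_tabloidMap_eq [CharZero K] (p : ℕ) (T : Fin n ≃ Fin m × Fin 2) :
    ∃ v ∈ (spechtModule K n (twoRows m)).toSubmodule, tabloidMap K p m n v =
      toRelFree K p n (linearization (fun i => (T i).2) (commPow K m)) := by
  refine ⟨((m + 1).factorial : K)⁻¹ • ∑ τ, flipSum K (shiftSecondRow T τ),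
    Submodule.smul_mem _ _ (sum_mem fun τ _ => flipSum_mem_spechtModule _), ?_⟩
  have h := congrArg (toRelFree K p n) (sum_flipSum_linearization (K := K) T)
  simp only [map_sum, map_smul] at h
  simp only [map_smul, map_sum, flipSum, tabloidMap_single]
  rw [h, smul_smul, inv_mul_cancel₀ (Nat.cast_ne_zero.mpr (m + 1).factorial_ne_zero), one_smul]

theorem isIrreducible_of_bijective {G V W : Type*} [Group G] [AddCommGroup V] [Module K V]
    [AddCommGroup W] [Module K W] {ρ : Representation K G V} {σ : Representation K G W}
    (f : ρ.IntertwiningMap σ) (hf : Function.Bijective f) (hρ : ρ.IsIrreducible) :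
    σ.IsIrreducible := by
  rw [Representation.irreducible_iff_isSimpleModule_asModule] at hρ ⊢
  let e := Representation.IntertwiningMap.equivLinearMapAsModule ρ σ f
  exact (LinearEquiv.isSimpleModule_iff (LinearEquiv.ofBijective e hf)).mp hρ

/-- The submodule of `F_n(𝔑_{m+1})` generated by the linearization of `[x₁, x₂]^m` is the image of
the Specht module. -/
theorem exists_bijective_intertwiningMap [CharZero K] (T : Fin n ≃ Fin m × Fin 2) :
    ∃ f : (spechtModule K n (twoRows m)).toRepresentation.IntertwiningMap
      (generatedBy (relFreeRep K (m + 1) n) (toRelFree K (m + 1) n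
        (linearization (fun i => (T i).2) (commPow K m)))).toRepresentation,
      Function.Bijective f := by
  set S := spechtModule K n (twoRows m) with hS
  set w := toRelFree K (m + 1) n (linearization (fun i => (T i).2) (commPow K m)) with hw
  set W := generatedBy (relFreeRep K (m + 1) n) w with hW
  set Φ := tabloidMap K (m + 1) m n with hΦ
  have hwW : w ∈ W.toSubmodule := Submodule.subset_span ⟨1, by simp⟩
  obtain ⟨v, hv, hvw⟩ := exists_mem_spechtModule_tabloidMap_eq (K := K) (m + 1) T
  change Φ v = w at hvw
  have hirr := isIrreducible_spechtModule_twoRows (K := K) T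
  have hS2 : ∀ U : Subrepresentation S.toRepresentation, U = ⊥ ∨ U = ⊤ :=
    hirr.eq_bot_or_eq_top
  have hw0 : w ≠ 0 := toRelFree_linearization_ne_zero T
  -- `U₁` is the preimage of `W` and `U₂` the kernel. The element `v`, with image `w ≠ 0`, lies in
  -- `U₁` and is nonzero, so `U₁` is everything; it does not lie in `U₂`, so `U₂` is zero.
  let U₁ : Subrepresentation S.toRepresentation :=
    { toSubmodule := W.toSubmodule.comap (Φ ∘ₗ S.toSubmodule.subtype)
      apply_mem_toSubmodule := by
        intro σ x hx
        have h := W.apply_mem_toSubmodule σ hx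
        simp only [LinearMap.comp_apply, Submodule.subtype_apply] at h
        rw [← tabloidMap_tabloidRep] at h
        exact h }
  let U₂ : Subrepresentation S.toRepresentation :=
    { toSubmodule := LinearMap.ker (Φ ∘ₗ S.toSubmodule.subtype)
      apply_mem_toSubmodule := by
        intro σ x hx
        have h : relFreeRep K (m + 1) n σ (Φ x) = 0 := by
          rw [show Φ x = 0 from hx, map_zero]
        rw [← tabloidMap_tabloidRep] at h
        exact h }
  have hU₁ : U₁ = ⊤ := by
    refine (hS2 U₁).resolve_left fun h => hw0 ?_
    have h2 : (⟨v, hv⟩ : S.toSubmodule) ∈ U₁.toSubmodule := by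
      change Φ v ∈ W.toSubmodule
      rw [hvw]
      exact hwW
    rw [h] at h2
    have h3 : v = 0 := congrArg Subtype.val ((Submodule.mem_bot K).mp h2)
    rw [← hvw, h3, map_zero]
  have hU₂ : U₂ = ⊥ := by
    refine (hS2 U₂).resolve_right fun h => hw0 ?_
    have h2 : (⟨v, hv⟩ : S.toSubmodule) ∈ U₂.toSubmodule := by
      rw [h]
      exact Submodule.mem_top
    rw [← hvw]
    exact h2
  have hmem : ∀ x : S.toSubmodule, (Φ ∘ₗ S.toSubmodule.subtype) x ∈ W.toSubmodule := by
    intro x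
    have h : x ∈ U₁.toSubmodule := by
      rw [hU₁]
      exact Submodule.mem_top
    exact h
  let f : S.toSubmodule →ₗ[K] W.toSubmodule :=
    (Φ ∘ₗ S.toSubmodule.subtype).codRestrict W.toSubmodule hmem
  refine ⟨⟨f, fun σ => LinearMap.ext fun x => Subtype.ext (tabloidMap_tabloidRep _ σ _)⟩, ?_, ?_⟩
  · change Function.Injective f
    intro x y hxy
    have h : x - y ∈ U₂.toSubmodule := by
      change Φ (x - y : (Fin n → ℕ) →₀ K) = 0
      rw [map_sub, sub_eq_zero]
      exact congrArg Subtype.val hxy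
    rw [hU₂] at h
    exact sub_eq_zero.mp ((Submodule.mem_bot K).mp h)
  · change Function.Surjective f
    rintro ⟨y, hy⟩
    suffices h : W.toSubmodule ≤ S.toSubmodule.map Φ by
      obtain ⟨x, hx, rfl⟩ := h hy
      exact ⟨⟨x, hx⟩, rfl⟩
    refine Submodule.span_le.mpr ?_
    rintro _ ⟨σ, rfl⟩
    exact ⟨tabloidRep K n σ v, S.apply_mem_toSubmodule σ hv,
      (tabloidMap_tabloidRep _ σ v).trans (congrArg _ hvw)⟩

theorem generatedBy_linearization_le (p : ℕ) (r : Fin n → Fin 2) :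
    generatedBy (relFreeRep K p n) (toRelFree K p n (linearization r (commPow K m))) ≤
      properMultilinearSubrep K p n := by
  have h : Submodule.span K (Set.range fun σ => relFreeRep K p n σ
      (toRelFree K p n (linearization r (commPow K m)))) ≤
      (properMultilinearSubrep K p n).toSubmodule := by
    refine Submodule.span_le.mpr ?_
    rintro _ ⟨σ, rfl⟩
    exact (properMultilinearSubrep K p n).apply_mem_toSubmodule σ
      ⟨_, linearization_commPow_mem_properMultilinear r, rfl⟩
  exact h

/-- The tableau of shape `(m, m)` with the entries in their natural order. -/
def standardTableau (m : ℕ) : Fin (2 * m) ≃ Fin m × Fin 2 :=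
  finProdFinEquiv.symm.trans (Equiv.prodComm _ _)

theorem standardTableau_snd (m : ℕ) (i : Fin (2 * m)) :
    (standardTableau m i).2 = if (i : ℕ) < m then 0 else 1 := by
  have h : ((standardTableau m i).2 : ℕ) = (i : ℕ) / m := rfl
  have hi := i.2
  have hm : 0 < m := by omega
  split_ifs with h1
  · exact Fin.ext (by rw [h, Nat.div_eq_of_lt h1]; rfl)
  · refine Fin.ext ?_
    rw [h]
    exact Nat.div_eq_of_lt_le (by omega) (by omega)

end Main

end LieNilpotent
end

theorem proposition3p3 (K : Type*) [Field K] [CharZero K] (p : ℕ) (hp : 1 ≤ p) :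
    -- the submodule `W` generated by the image of the linearization in `F_{2p-2}(𝔑_p)`
    let W : Subrepresentation (LieNilpotent.relFreeRep K p (2 * p - 2)) :=
      LieNilpotent.generatedBy (LieNilpotent.relFreeRep K p (2 * p - 2))
        (LieNilpotent.toRelFree K p (2 * p - 2) (LieNilpotent.commPowLin K p))
    W ≤ LieNilpotent.properMultilinearSubrep K p (2 * p - 2) ∧
      W.toRepresentation.IsIrreducible ∧
      Nonempty (W.toRepresentation.Equiv
        (LieNilpotent.spechtModule K (2 * p - 2)
          (LieNilpotent.twoRows (p - 1))).toRepresentation) ∧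
      ¬ LieNilpotent.IsIdentity (LieNilpotent.commPow K (p - 1))
        (LieNilpotent.GrassmannPower K 2 (p - 1)) ∧
      ¬ LieNilpotent.IsIdentity (LieNilpotent.commPowLin K p)
        (LieNilpotent.GrassmannPower K 2 (p - 1)) := by
  obtain ⟨m, rfl⟩ : ∃ m, p = m + 1 := ⟨p - 1, by omega⟩
  -- The degree `2 * (m + 1) - 2` is definitionally `2 * m`.
  let T : Fin (2 * (m + 1) - 2) ≃ Fin m × Fin 2 := LieNilpotent.standardTableau m
  have hT : LieNilpotent.commPowLin K (m + 1) =
      LieNilpotent.linearization (fun i => (T i).2) (LieNilpotent.commPow K m) := by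
    have h : (fun i => (T i).2) = fun j : Fin (2 * (m + 1) - 2) =>
        if (j : ℕ) < m + 1 - 1 then (0 : Fin 2) else 1 :=
      funext fun i => LieNilpotent.standardTableau_snd m i
    rw [h]
    rfl
  rw [hT]
  obtain ⟨f, hf⟩ := LieNilpotent.exists_bijective_intertwiningMap (K := K) T
  refine ⟨LieNilpotent.generatedBy_linearization_le _ _, ?_, ⟨(f.ofBijective hf).symm⟩,
    LieNilpotent.not_isIdentity_commPow, LieNilpotent.not_isIdentity_linearization T⟩
  exact LieNilpotent.isIrreducible_of_bijective
    (V := (LieNilpotent.spechtModule K (2 * (m + 1) - 2) (LieNilpotent.twoRows m)).toSubmodule) f hf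
    (LieNilpotent.isIrreducible_spechtModule_twoRows T)
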